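/- Let $n\ge 1$ and $\ell\in\{1,\dots,n\}$, and let $K_0,K_1,K_2,\dots$ be real numbers. Then there is a constant $C$, depending only on $n$, $\ell$ and $(K_j)$, such that the following holds. Let $\Omega\subset\mathbb R^n$ be a bounded open set that is star shaped with respect to an open ball $B\subset\Omega$, i.e. for every $y\in\Omega$ the convex hull of $B\cup\{y\}$ is contained in $\Omega$. Set $R=\operatorname{diam}\Omega$ and $\rho=\operatorname{diam}B$. Let $\theta\in C_0^\infty(\mathbb R^n)$ be supported in $\overline B$, with $\int\theta\,dx=1$ and, for every multi-index $\alpha$, \[ \|\partial^\alpha\theta\|_{L^1}\le \frac{K_{|\alpha|}}{\rho^{|\alpha|}},\qquad \|\partial^\alpha\theta\|_{L^\infty}\le \frac{K_{|\alpha|}}{\rho^{n+|\alpha|}} . \] For an integer $m$ let $G_m(x,y)=\int_1^\infty (t-1)^{n-m}t^{m-1}\theta(y+t(x-y))\,dt$, and for an $\ell$-form $u=\sum_I u_I\,dx_I$ on $\Omega$ (sum over $I=(i_1<\dots<i_\ell)$) with all $u_I\in L^2(\Omega)$ let \[ \mathtt P_\ell u(x)=\int_\Omega G_{n-\ell+1}(y,x)\,(x-y)\lrcorner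 u(y)\,dy , \] where $z\lrcorner u(y)=u(y)(z,\cdot,\dots,\cdot)$ is the interior product. Then this integral converges absolutely for almost every $x\in\Omega$, all coefficients of the $(\ell-1)$-form $\mathtt P_\ell u$ belong to $H^1(\Omega)$, and \[ |\mathtt P_\ell u|_{H^1(\Omega,\Lambda^{\ell-1})}\le C\,\frac R\rho\,\kappa\,\|u\|_{L^2(\Omega,\Lambda^\ell)} . \] Here $\|u\|_{L^2(\Omega,\Lambda^\ell)}^2=\sum_I\|u_I\|_{L^2(\Omega)}^2$, $|w|_{H^1(\Omega,\Lambda^{\ell-1})}^2=\sum_I\sum_{j=1}^n\|\partial_j w_I\|_{L^2(\Omega)}^2$ with weak derivatives $\partial_j$, and \[ \kappa=\begin{cases} 1, & 2\ell>n,\\[4pt] 1+\left(\dfrac{|\Omega|}{|B|}\right)^{\frac{n-2\ell}{2(n-\ell)}}\left(\log\dfrac{|\Omega|}{|B|}\right)^{\frac{n}{2(n-\ell)}}, & 2\ell\in\{n-1,n\},\\[8pt] 1+\left(\dfrac{|\Omega|}{|B|}\right)^{\frac{n-2\ell}{2(n-\ell)}}\left(\log\dfrac{|\Omega|}{|B|}\right)^{\frac{n}{2(n-\ell-1)}},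 & 2\ell\le n-2. \end{cases} \] -/

import Mathlib

namespace PoincareEstimate

open MeasureTheory
open scoped ContDiff

/-- Euclidean space `ℝⁿ`. -/
abbrev E (n : ℕ) : Type := EuclideanSpace ℝ (Fin n)

/-- Exterior `ℓ`-forms on `ℝⁿ`: alternating `ℓ`-linear functions on `ℝⁿ`
(continuity is automatic in finite dimension). -/
abbrev Form (n ℓ : ℕ) : Type := E n [⋀^Fin ℓ]→L[ℝ] ℝ

noncomputable section

/-- The canonical basis vector `e_i` of `ℝⁿ`. -/
def e {n : ℕ} (i : Fin n) : E n := EuclideanSpace.single i 1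

/-- The coefficient `η_I = η(e_{i₁}, …, e_{i_ℓ})` of `dx_I` in `η = ∑_I η_I dx_I`, where
`I = (i₁ < ⋯ < i_ℓ)` is a strictly increasing multi-index. -/
def coeff {n ℓ : ℕ} (I : Fin ℓ ↪o Fin n) (η : Form n ℓ) : ℝ := η (fun m => e (I m))

/-- The interior product `z ⌟ η = η(z, ·, …, ·)` of a vector with a `(k+1)`-form. On basis forms it
is `z ⌟ dx_I = ∑_m (-1)^(m-1) z_{i_m} dx_{Î_m}`, with `Î_m` the multi-index `I` without `i_m`. -/
def contract {n k : ℕ} (z : E n) (η : Form n (k + 1)) : Form n k := η.curryLeft z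

/-- `D` is star shaped with respect to `B`: `B ⊆ D`, and for every `y ∈ D` the convex hull of
`B ∪ {y}` is contained in `D`. -/
def StarShapedWrt {n : ℕ} (D B : Set (E n)) : Prop :=
  B ⊆ D ∧ ∀ y ∈ D, convexHull ℝ (B ∪ {y}) ⊆ D

/-- The partial derivative `∂_{i₁} ⋯ ∂_{i_k} θ` at `x`. -/
def partialDeriv {n k : ℕ} (i : Fin k → Fin n) (θ : E n → ℝ) (x : E n) : ℝ :=
  iteratedFDeriv ℝ k θ x (fun m => e (i m))

/-- `θ` is a smooth function supported in the (closed) ball with centre `c` and radius `r`, with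
integral one, all of whose partial derivatives of order `k` are bounded by `K k / ρ ^ k` in `L¹`
and by `K k / ρ ^ (n + k)` in `L^∞`, where `ρ` is the diameter of the ball. -/
structure IsRegularizer {n : ℕ} (K : ℕ → ℝ) (c : E n) (r : ℝ) (θ : E n → ℝ) : Prop where
  contDiff : ContDiff ℝ ∞ θ
  tsupport_subset : tsupport θ ⊆ Metric.closedBall c r
  integral_eq_one : ∫ x, θ x = 1
  l1_bound : ∀ (k : ℕ) (i : Fin k → Fin n),
    ∫ x, |partialDeriv i θ x| ≤ K k / Metric.diam (Metric.ball c r) ^ k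
  sup_bound : ∀ (k : ℕ) (i : Fin k → Fin n) (x : E n),
    |partialDeriv i θ x| ≤ K k / Metric.diam (Metric.ball c r) ^ (n + k)

/-- The kernel `G_m(x, y) = ∫_1^∞ (t-1)^(n-m) t^(m-1) θ(y + t (x - y)) dt`
(the exponents are integers). -/
def G {n : ℕ} (θ : E n → ℝ) (m : ℤ) (x y : E n) : ℝ :=
  ∫ t in Set.Ioi (1 : ℝ), (t - 1) ^ ((n : ℤ) - m) * t ^ (m - 1) * θ (y + t • (x - y))

/-- The integrand `G_{n-ℓ+1}(y, x) (x - y) ⌟ u(y)` of the Poincaré-type operator on `ℓ`-forms,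
with `ℓ = k + 1`. -/
def poincareIntegrand {n k : ℕ} (θ : E n → ℝ) (u : E n → Form n (k + 1)) (x y : E n) : Form n k :=
  G θ ((n : ℤ) - ((k + 1 : ℕ) : ℤ) + 1) y x • contract (x - y) (u y)

/-- The regularized Poincaré-type operator `P_ℓ u(x) = ∫_Ω G_{n-ℓ+1}(y, x) (x - y) ⌟ u(y) dy`
applied to an `ℓ`-form `u` on `Ω`, with `ℓ = k + 1`. -/
def poincareOp {n k : ℕ} (Ω : Set (E n)) (θ : E n → ℝ) (u : E n → Form n (k + 1)) (x : E n) :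
    Form n k :=
  ∫ y in Ω, poincareIntegrand θ u x y

/-- `g` is the weak partial derivative `∂_j f` on the open set `Ω`. -/
def HasWeakPartial {n : ℕ} (Ω : Set (E n)) (j : Fin n) (f g : E n → ℝ) : Prop :=
  LocallyIntegrableOn f Ω ∧ LocallyIntegrableOn g Ω ∧
    ∀ φ : E n → ℝ, ContDiff ℝ ∞ φ → HasCompactSupport φ → tsupport φ ⊆ Ω →
      ∫ x in Ω, f x * fderiv ℝ φ x (e j) = -∫ x in Ω, g x * φ x

/-- `f ∈ H¹(Ω)`: `f` and its first-order weak derivatives are in `L²(Ω)`. -/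
def MemH1 {n : ℕ} (Ω : Set (E n)) (f : E n → ℝ) : Prop :=
  MemLp f 2 (volume.restrict Ω) ∧
    ∀ j : Fin n, ∃ g : E n → ℝ, HasWeakPartial Ω j f g ∧ MemLp g 2 (volume.restrict Ω)

open Classical in
/-- A representative of the weak partial derivative `∂_j f` on `Ω` (unique up to null sets);
zero if there is none. -/
def weakPartial {n : ℕ} (Ω : Set (E n)) (j : Fin n) (f : E n → ℝ) : E n → ℝ :=
  if h : ∃ g : E n → ℝ, HasWeakPartial Ω j f g then h.choose else 0

/-- `u ∈ L²(Ω, Λ^ℓ)`: all coefficients of `u` are in `L²(Ω)`. -/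
def MemL2Form {n ℓ : ℕ} (Ω : Set (E n)) (u : E n → Form n ℓ) : Prop :=
  ∀ I : Fin ℓ ↪o Fin n, MemLp (fun x => coeff I (u x)) 2 (volume.restrict Ω)

/-- `‖u‖_{L²(Ω, Λ^ℓ)} = (∑_I ‖u_I‖²_{L²(Ω)})^(1/2)`. -/
def l2NormForm {n ℓ : ℕ} (Ω : Set (E n)) (u : E n → Form n ℓ) : ℝ :=
  √(∑ I : Fin ℓ ↪o Fin n, ∫ x in Ω, coeff I (u x) ^ 2)

/-- `w ∈ H¹(Ω, Λ^ℓ)`: all coefficients of `w` are in `H¹(Ω)`. -/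
def MemH1Form {n ℓ : ℕ} (Ω : Set (E n)) (w : E n → Form n ℓ) : Prop :=
  ∀ I : Fin ℓ ↪o Fin n, MemH1 Ω (fun x => coeff I (w x))

/-- `|w|_{H¹(Ω, Λ^ℓ)} = (∑_I ∑_j ‖∂_j w_I‖²_{L²(Ω)})^(1/2)`. -/
def h1SeminormForm {n ℓ : ℕ} (Ω : Set (E n)) (w : E n → Form n ℓ) : ℝ :=
  √(∑ I : Fin ℓ ↪o Fin n, ∑ j : Fin n,
      ∫ x in Ω, weakPartial Ω j (fun y => coeff I (w y)) x ^ 2)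

/-- The factor `κ`, as a function of `n`, `ℓ` and the ratio `q = |Ω| / |B|`. -/
def kappa (n ℓ : ℕ) (q : ℝ) : ℝ :=
  if n < 2 * ℓ then 1
  else if n ≤ 2 * ℓ + 1 then
    1 + q ^ (((n : ℝ) - 2 * ℓ) / (2 * ((n : ℝ) - ℓ))) *
      Real.log q ^ ((n : ℝ) / (2 * ((n : ℝ) - ℓ)))
  else
    1 + q ^ (((n : ℝ) - 2 * ℓ) / (2 * ((n : ℝ) - ℓ))) *
      Real.log q ^ ((n : ℝ) / (2 * ((n : ℝ) - ℓ - 1)))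

end

end PoincareEstimate

/-! ### Cauchy–Schwarz, dilations and Plancherel on L¹ ∩ L² -/

namespace PoincareEstimate

open MeasureTheory FourierTransform
open scoped ContDiff ENNReal

/-! Duality reduces the H¹ bound to a bilinear one. Each coefficient of the potential is a finite
sum of scalar operators `scalarOp` applied to components of u extended by zero. By Riesz
representation (`exists_hasWeakPartial`) it suffices to bound ∫ (Tv) ∂_jφ, for such an operator T
and a test function φ, by a multiple of ‖φ‖₂‖v‖₂. Fubini turns this pairing into an integral over
the scale t > 1 of ∬ ∂_jφ(x) (x-y)_i v(y) θ(a), where a = ty - (t-1)x.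

The key identity is t(x-y) = (x-c) - (a-c), with c the centre of B. The factor (x-c)_i joins the
test function and costs R; the factor (a-c)_i joins θ and costs ρ. Integration by parts in x then
moves ∂_j to the function of a at the price of a factor t-1 (`integral_fderiv_mul_slice`). What
remains is `scalePairing f` for f = θ, and, with the extra t-1, for f = ∂_jθ and f = ∂_j((z-c)_i θ).
Since ∂_jθ costs 1/ρ, the ratio R/ρ appears.

Scales t > 2: a Schur bound gives O(t^{-n}). This suffices for θ, whose weight is at most t^{n-2},
but diverges logarithmically for the derivative terms, whose weight grows like t^{n-1}. There the
cancellation in f is used: its Fourier transform vanishes at 0 and decays at infinity. The pairing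
equals ∫ f̂(ζ) φ̂((t-1)ζ) v̂(-tζ) dζ, and after Cauchy–Schwarz and a dilation only ∫ |f̂(η/t)| dt/t
matters, which is bounded uniformly in η (`lintegral_dilation_le`).

Scales 1 < t ≤ 2, with σ = t-1: the Schur test gives σ^{-n/2} from the L¹ norm of f and √Q, Q =
|Ω|/ρ^n, from its sup norm. The integral of σ^{ℓ-1} min(σ^{-n/2}, √Q) over (0,1] is the source of κ
(`exists_lintegral_min_le_kappa`). -/

theorem eLpNorm_two_eq_lintegral {α F : Type*} [MeasurableSpace α] [ENorm F] (μ : Measure α)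
    (f : α → F) : eLpNorm f 2 μ = (∫⁻ x, ‖f x‖ₑ ^ 2 ∂μ) ^ (1 / 2 : ℝ) := by
  rw [eLpNorm_eq_lintegral_rpow_enorm_toReal (by simp) (by simp)]
  simp

/-- Cauchy–Schwarz inequality for a weighted integral. -/
theorem lintegral_mul_mul_le {α : Type*} [MeasurableSpace α] (μ : Measure α) {w X Y : α → ℝ≥0∞}
    (hw : Measurable w) (hX : Measurable X) (hY : Measurable Y) :
    ∫⁻ a, w a * (X a * Y a) ∂μ ≤
      (∫⁻ a, w a * X a ^ 2 ∂μ) ^ (1 / 2 : ℝ) * (∫⁻ a, w a * Y a ^ 2 ∂μ) ^ (1 / 2 : ℝ) := by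
  have h := ENNReal.lintegral_mul_le_Lp_mul_Lq (μ.withDensity w) (p := 2) (q := 2)
    (Real.HolderConjugate.two_two) hX.aemeasurable hY.aemeasurable
  rw [lintegral_withDensity_eq_lintegral_mul _ hw (hX.mul hY),
    lintegral_withDensity_eq_lintegral_mul _ hw (hX.pow_const _),
    lintegral_withDensity_eq_lintegral_mul _ hw (hY.pow_const _)] at h
  simpa using h

theorem lintegral_comp_smul {n : ℕ} {f : E n → ℝ≥0∞} (hf : Measurable f) {t : ℝ} (ht : 0 < t) :
    ∫⁻ x, f (t • x) = ENNReal.ofReal (t ^ n)⁻¹ * ∫⁻ x, f x := by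
  have h := lintegral_map (μ := (volume : Measure (E n))) hf (measurable_const_smul t)
  rw [Measure.map_addHaar_smul _ ht.ne', lintegral_smul_measure] at h
  rw [← h, finrank_euclideanSpace_fin, abs_of_pos (by positivity), smul_eq_mul]

theorem continuous_fourier_of_integrable {n : ℕ} {v : E n → ℂ} (hv : Integrable v) :
    Continuous (𝓕 v) :=
  VectorFourier.fourierIntegral_continuous Real.continuous_fourierChar
    (by exact continuous_inner) hv

/-- Plancherel's identity for functions in `L¹ ∩ L²`. -/
theorem eLpNorm_fourier_eq {n : ℕ} {v : E n → ℂ} (hv : Integrable v)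
    (hv2 : MemLp v 2) : eLpNorm (𝓕 v) 2 volume = eLpNorm v 2 volume := by
  set V : Lp ℂ 2 (volume : Measure (E n)) := hv2.toLp v
  have key : 𝓕 v =ᵐ[volume] ((𝓕 V : Lp ℂ 2 (volume : Measure (E n))) : E n → ℂ) := by
    -- The integral transform and the L² transform are identified by testing against smooth
    -- compactly supported g: the multiplication formula ∫ v̂ S = ∫ v Ŝ is also the definition of
    -- the transform of a tempered distribution, with which the L² transform is compatible.
    refine ae_eq_of_integral_contDiff_smul_eq
      (continuous_fourier_of_integrable hv).locallyIntegrable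
      ((Lp.memLp _).locallyIntegrable (by norm_num)) fun g hg hgc => ?_
    have hgc' : HasCompactSupport (fun x => (g x : ℂ)) := hgc.comp_left Complex.ofReal_zero
    have hg' : ContDiff ℝ ∞ (fun x => (g x : ℂ)) := Complex.ofRealCLM.contDiff.comp hg
    set S : SchwartzMap (E n) ℂ := hgc'.toSchwartzMap hg'
    have h1 := congrArg (fun T : TemperedDistribution (E n) ℂ => T S)
      (Lp.fourier_toTemperedDistribution_eq V)
    simp only [TemperedDistribution.fourier_apply, Lp.toTemperedDistribution_apply] at h1
    have h2 : ∫ ξ, 𝓕 v ξ • S ξ = ∫ x, v x • 𝓕 (S : E n → ℂ) x := by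
      have := VectorFourier.integral_fourierIntegral_smul_eq_flip (μ := volume) (ν := volume)
        (L := innerₗ (E n)) Real.continuous_fourierChar
        (by exact continuous_inner) hv S.integrable
      rw [flip_innerₗ] at this
      exact this
    have h3 : ∫ x, (𝓕 S) x • (V : E n → ℂ) x = ∫ x, v x • 𝓕 (S : E n → ℂ) x := by
      refine integral_congr_ae ?_
      filter_upwards [hv2.coeFn_toLp] with x hx
      rw [show (V : E n → ℂ) x = v x from hx, SchwartzMap.fourier_coe, smul_eq_mul, smul_eq_mul,
        mul_comm]
    calc ∫ x, g x • 𝓕 v x = ∫ ξ, 𝓕 v ξ • S ξ := by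
          refine integral_congr_ae (.of_forall fun x => ?_)
          simp [S, mul_comm]
      _ = ∫ x, S x • ((𝓕 V : Lp ℂ 2 (volume : Measure (E n))) : E n → ℂ) x := by
          rw [h2, ← h3, h1]
      _ = _ := by
          refine integral_congr_ae (.of_forall fun x => ?_)
          simp [S]
  rw [eLpNorm_congr_ae key, ← eLpNorm_congr_ae hv2.coeFn_toLp, ← Lp.enorm_def, ← Lp.enorm_def]
  rw [← ofReal_norm, ← ofReal_norm, Lp.norm_fourier_eq]

end PoincareEstimate

/-! ### Fourier representation of the pairing and the singular large scales -/

namespace PoincareEstimate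

open MeasureTheory FourierTransform
open scoped ContDiff ENNReal

noncomputable section

/-- The bilinear form `∫∫ φ(x) v(y) f(t y - (t - 1) x) dx dy`. -/
def scalePairing {n : ℕ} (f φ v : E n → ℝ) (t : ℝ) : ℝ :=
  ∫ p : E n × E n, φ p.1 * v p.2 * f (t • p.2 - (t - 1) • p.1)

/-- The complex-valued function underlying a real-valued one. -/
abbrev toC {n : ℕ} (f : E n → ℝ) : E n → ℂ := fun x => (f x : ℂ)

theorem fourierInv_fourier_apply {n : ℕ} {f : E n → ℝ} (hf : ContDiff ℝ ∞ f)
    (hfc : HasCompactSupport f) (a : E n) :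
    (f a : ℂ) = ∫ ζ, 𝐞 (inner ℝ ζ a) • 𝓕 (toC f) ζ := by
  have hfc' : HasCompactSupport (toC f) := hfc.comp_left Complex.ofReal_zero
  have hf' : ContDiff ℝ ∞ (toC f) := Complex.ofRealCLM.contDiff.comp hf
  set S : SchwartzMap (E n) ℂ := hfc'.toSchwartzMap hf'
  have h1 : 𝓕⁻ (𝓕 (toC f)) = toC f := by
    refine Continuous.fourierInv_fourier_eq hf'.continuous
      (hf'.continuous.integrable_of_hasCompactSupport hfc') ?_
    exact (𝓕 S).integrable
  rw [← Real.fourierInv_eq, h1]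

theorem integrable_fourier_of_contDiff {n : ℕ} {f : E n → ℝ} (hf : ContDiff ℝ ∞ f)
    (hfc : HasCompactSupport f) : Integrable (𝓕 (toC f)) := by
  have hfc' : HasCompactSupport (toC f) := hfc.comp_left Complex.ofReal_zero
  have hf' : ContDiff ℝ ∞ (toC f) := Complex.ofRealCLM.contDiff.comp hf
  exact (𝓕 (hfc'.toSchwartzMap hf')).integrable

/-- Fourier representation of `scalePairing`. -/
theorem scalePairing_eq_fourier {n : ℕ} {f φ v : E n → ℝ} (hf : ContDiff ℝ ∞ f)
    (hfc : HasCompactSupport f) (hφ : Integrable φ) (hv : Integrable v) (t : ℝ) :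
    (scalePairing f φ v t : ℂ) =
      ∫ ζ, 𝓕 (toC f) ζ * (𝓕 (toC φ) ((t - 1) • ζ) * 𝓕 (toC v) (-(t • ζ))) := by
  have hφ' : Integrable (toC φ) := hφ.ofReal
  have hv' : Integrable (toC v) := hv.ofReal
  have hF := integrable_fourier_of_contDiff hf hfc
  have hint : Integrable (fun q : (E n × E n) × E n =>
      𝐞 (inner ℝ q.2 (t • q.1.2 - (t - 1) • q.1.1)) •
        ((toC φ q.1.1 * toC v q.1.2) * 𝓕 (toC f) q.2))
      ((volume : Measure (E n × E n)).prod volume) := by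
    have h1 : Integrable (fun q : (E n × E n) × E n =>
        ((toC φ q.1.1 * toC v q.1.2) * 𝓕 (toC f) q.2)) (volume.prod volume) :=
      (hφ'.mul_prod hv').mul_prod hF
    refine (integrable_norm_iff ?_).1 ?_
    · refine AEStronglyMeasurable.fun_smul (Continuous.aestronglyMeasurable ?_)
        h1.aestronglyMeasurable
      exact Real.continuous_fourierChar.comp (by fun_prop)
    · simpa only [Circle.norm_smul] using h1.norm
  calc (scalePairing f φ v t : ℂ)
      = ∫ p : E n × E n, ∫ ζ, 𝐞 (inner ℝ ζ (t • p.2 - (t - 1) • p.1)) •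
        ((toC φ p.1 * toC v p.2) * 𝓕 (toC f) ζ) := by
        rw [scalePairing, ← integral_complex_ofReal]
        refine integral_congr_ae (.of_forall fun p => ?_)
        simp only [Complex.ofReal_mul]
        rw [fourierInv_fourier_apply hf hfc, ← integral_const_mul]
        refine integral_congr_ae (.of_forall fun ζ => ?_)
        simp only [Circle.smul_def, smul_eq_mul]
        ring
    _ = ∫ ζ, ∫ p : E n × E n, 𝐞 (inner ℝ ζ (t • p.2 - (t - 1) • p.1)) •
        ((toC φ p.1 * toC v p.2) * 𝓕 (toC f) ζ) := integral_integral_swap hint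
    _ = _ := by
        refine integral_congr_ae (.of_forall fun ζ => ?_)
        simp only [Real.fourier_eq (toC φ), Real.fourier_eq (toC v)]
        rw [← integral_prod_mul, ← integral_const_mul]
        refine integral_congr_ae (.of_forall fun p => ?_)
        -- The phase separates in x and y, so the double integral is a product of two transforms at
        -- dilated frequencies.
        have : 𝐞 (inner ℝ ζ (t • p.2 - (t - 1) • p.1)) =
            𝐞 (-inner ℝ p.1 ((t - 1) • ζ)) * 𝐞 (-inner ℝ p.2 (-(t • ζ))) := by
          rw [← AddChar.map_add_eq_mul]
          congr 1
          simp only [inner_sub_right, inner_smul_right, inner_neg_right, real_inner_comm ζ]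
          ring
        simp only [this, Circle.smul_def, Circle.coe_mul, smul_eq_mul]
        ring

theorem enorm_scalePairing_le_fourier {n : ℕ} {f φ v : E n → ℝ} (hf : ContDiff ℝ ∞ f)
    (hfc : HasCompactSupport f) (hφ : Integrable φ) (hv : Integrable v) (t : ℝ) :
    ‖scalePairing f φ v t‖ₑ ≤
      ∫⁻ ζ, ‖𝓕 (toC f) ζ‖ₑ * (‖𝓕 (toC φ) ((t - 1) • ζ)‖ₑ * ‖𝓕 (toC v) (-(t • ζ))‖ₑ) := by
  have h : ‖scalePairing f φ v t‖ₑ = ‖(scalePairing f φ v t : ℂ)‖ₑ := by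
    rw [← ofReal_norm, ← ofReal_norm, Complex.norm_real]
  rw [h, scalePairing_eq_fourier hf hfc hφ hv]
  refine (enorm_integral_le_lintegral_enorm _).trans_eq ?_
  simp only [enorm_mul]

/-- The Cauchy kernel has mass π whatever its width a; this uniformity is what makes the dilation
estimate independent of the frequency. -/
theorem lintegral_cauchy_kernel_le {a : ℝ} (ha : 0 ≤ a) :
    ∫⁻ t in Set.Ioi (0 : ℝ), ENNReal.ofReal (a / (t ^ 2 + a ^ 2)) ≤ ENNReal.ofReal Real.pi := by
  rcases ha.eq_or_lt with rfl | ha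
  · simp
  refine (setLIntegral_le_lintegral _ _).trans ?_
  have hint : Integrable (fun t : ℝ => a⁻¹ * (1 + (a⁻¹ * t) ^ 2)⁻¹) :=
    (integrable_inv_one_add_sq.comp_mul_left' (by positivity)).const_mul _
  have : ∀ t : ℝ, a / (t ^ 2 + a ^ 2) = a⁻¹ * (1 + (a⁻¹ * t) ^ 2)⁻¹ := fun t => by
    have : t ^ 2 + a ^ 2 ≠ 0 := by positivity
    field_simp
    ring
  simp only [this]
  rw [← ofReal_integral_eq_lintegral_ofReal hint (.of_forall fun t => by positivity),
    integral_const_mul, Measure.integral_comp_mul_left (fun t => (1 + t ^ 2)⁻¹),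
    integral_univ_inv_one_add_sq]
  refine ENNReal.ofReal_le_ofReal (le_of_eq ?_)
  rw [inv_inv, abs_of_pos ha, smul_eq_mul]
  field_simp

/-- A dilation estimate: integrating the dilates of `H` against a function with the decay of the
Fourier transform of a derivative. -/
theorem lintegral_dilation_le {n : ℕ} (hn : 1 ≤ n) {F : E n → ℂ} (hF : Continuous F) {A ρ : ℝ}
    (hA : 0 ≤ A) (hρ : 0 < ρ) (hFA : ∀ ζ, ‖F ζ‖ ≤ A * (ρ * ‖ζ‖ / (1 + (ρ * ‖ζ‖) ^ 2)))
    {H : E n → ℝ≥0∞} (hH : Measurable H) :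
    ∫⁻ t in Set.Ioi (0 : ℝ), ∫⁻ ζ, ENNReal.ofReal (t ^ (n - 1)) * ‖F ζ‖ₑ * H (t • ζ) ≤
      ENNReal.ofReal (A * Real.pi) * ∫⁻ η, H η := by
  -- Substitute η = tζ: the Jacobian t^{-n} against t^{n-1} leaves 1/t, and 1/t times the decay of F
  -- at η/t is A times the Cauchy kernel in t of width ρ‖η‖.
  have h1 : ∀ t ∈ Set.Ioi (0 : ℝ),
      ∫⁻ ζ, ENNReal.ofReal (t ^ (n - 1)) * ‖F ζ‖ₑ * H (t • ζ) ≤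
        ∫⁻ η, ENNReal.ofReal (A * (ρ * ‖η‖ / (t ^ 2 + (ρ * ‖η‖) ^ 2))) * H η := by
    intro t ht
    have ht : 0 < t := ht
    have hm : Measurable fun η => ‖F (t⁻¹ • η)‖ₑ * H η :=
      (hF.measurable.comp (measurable_const_smul _)).enorm.mul hH
    have h2 := lintegral_comp_smul hm ht
    simp only [smul_smul, inv_mul_cancel₀ ht.ne', one_smul] at h2
    simp only [mul_assoc]
    rw [lintegral_const_mul' _ _ ENNReal.ofReal_ne_top, h2, ← mul_assoc,
      ← ENNReal.ofReal_mul (by positivity), ← lintegral_const_mul' _ _ ENNReal.ofReal_ne_top]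
    refine lintegral_mono fun η => ?_
    rw [← mul_assoc]
    gcongr
    rw [← ofReal_norm, ← ENNReal.ofReal_mul (by positivity)]
    refine ENNReal.ofReal_le_ofReal ?_
    have e1 : t ^ (n - 1) * (t ^ n)⁻¹ = t⁻¹ := by
      obtain ⟨m, rfl⟩ : ∃ m, n = m + 1 := ⟨n - 1, by omega⟩
      have : t ^ m ≠ 0 := by positivity
      rw [Nat.add_sub_cancel, pow_succ]
      field_simp
    rw [e1]
    refine (mul_le_mul_of_nonneg_left (hFA _) (by positivity)).trans (le_of_eq ?_)
    rw [norm_smul, norm_inv, Real.norm_of_nonneg ht.le]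
    have : t ^ 2 + (ρ * ‖η‖) ^ 2 ≠ 0 := by positivity
    have : 1 + (ρ * (t⁻¹ * ‖η‖)) ^ 2 ≠ 0 := by positivity
    field_simp
  refine (setLIntegral_mono' measurableSet_Ioi h1).trans ?_
  rw [lintegral_lintegral_swap (by fun_prop), ← lintegral_const_mul _ hH]
  refine lintegral_mono fun η => ?_
  simp only
  rw [lintegral_mul_const _ (by fun_prop)]
  gcongr
  simp only [ENNReal.ofReal_mul hA]
  rw [lintegral_const_mul _ (by fun_prop)]
  gcongr
  exact lintegral_cauchy_kernel_le (by positivity)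

theorem lintegral_Ioi_comp_sub_one (g : ℝ → ℝ≥0∞) :
    ∫⁻ t in Set.Ioi (2 : ℝ), g (t - 1) = ∫⁻ t in Set.Ioi (1 : ℝ), g t := by
  rw [← lintegral_indicator measurableSet_Ioi, ← lintegral_indicator measurableSet_Ioi,
    ← lintegral_sub_right_eq_self ((Set.Ioi (1 : ℝ)).indicator g) (1 : ℝ)]
  refine lintegral_congr fun t => ?_
  have : t ∈ Set.Ioi (2 : ℝ) ↔ t - 1 ∈ Set.Ioi (1 : ℝ) := by
    simp only [Set.mem_Ioi]
    constructor <;> intro h <;> linarith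
  by_cases h : t - 1 ∈ Set.Ioi (1 : ℝ)
  · rw [Set.indicator_of_mem h, Set.indicator_of_mem (this.2 h)]
  · rw [Set.indicator_of_notMem h, Set.indicator_of_notMem (fun h' => h (this.1 h'))]

theorem lintegral_enorm_fourier_sq {n : ℕ} {v : E n → ℝ} (hv : Integrable v) (hv2 : MemLp v 2) :
    (∫⁻ η, ‖𝓕 (toC v) η‖ₑ ^ 2) ^ (1 / 2 : ℝ) = eLpNorm v 2 volume := by
  rw [← eLpNorm_two_eq_lintegral, eLpNorm_fourier_eq (v := toC v) hv.ofReal hv2.ofReal]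
  refine eLpNorm_congr_norm_ae (.of_forall fun x => ?_)
  simp

/-- Boundedness on `L²` of the singular part of the operator. -/
theorem lintegral_scalePairing_large_le {n : ℕ} (hn : 1 ≤ n) {f φ v : E n → ℝ}
    (hf : ContDiff ℝ ∞ f) (hfc : HasCompactSupport f) (hφ : Integrable φ) (hφ2 : MemLp φ 2)
    (hv : Integrable v) (hv2 : MemLp v 2) {A ρ : ℝ} (hA : 0 ≤ A) (hρ : 0 < ρ)
    (hFA : ∀ ζ, ‖𝓕 (toC f) ζ‖ ≤ A * (ρ * ‖ζ‖ / (1 + (ρ * ‖ζ‖) ^ 2))) :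
    ∫⁻ t in Set.Ioi (2 : ℝ), ENNReal.ofReal (t ^ (n - 1)) * ‖scalePairing f φ v t‖ₑ ≤
      ENNReal.ofReal (2 ^ n * A * Real.pi) * eLpNorm φ 2 volume * eLpNorm v 2 volume := by
  have hcf : Continuous (𝓕 (toC f)) := continuous_fourier_of_integrable
    (hf.continuous.integrable_of_hasCompactSupport hfc).ofReal
  have hcφ : Continuous (𝓕 (toC φ)) := continuous_fourier_of_integrable hφ.ofReal
  have hcv : Continuous (𝓕 (toC v)) := continuous_fourier_of_integrable hv.ofReal
  set μ : Measure (ℝ × E n) := (volume.restrict (Set.Ioi (2 : ℝ))).prod volume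
  set w : ℝ × E n → ℝ≥0∞ := fun p => ENNReal.ofReal (p.1 ^ (n - 1)) * ‖𝓕 (toC f) p.2‖ₑ
  set X : ℝ × E n → ℝ≥0∞ := fun p => ‖𝓕 (toC φ) ((p.1 - 1) • p.2)‖ₑ
  set Y : ℝ × E n → ℝ≥0∞ := fun p => ‖𝓕 (toC v) (-(p.1 • p.2))‖ₑ
  have hw : Measurable w := by
    refine Measurable.mul (by fun_prop) (hcf.measurable.comp measurable_snd).enorm
  have hX : Measurable X := (Continuous.measurable (hcφ.comp (by fun_prop))).enorm
  have hY : Measurable Y := (Continuous.measurable (hcv.comp (by fun_prop))).enorm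
  have step : ∫⁻ t in Set.Ioi (2 : ℝ), ENNReal.ofReal (t ^ (n - 1)) * ‖scalePairing f φ v t‖ₑ ≤
      ∫⁻ p, w p * (X p * Y p) ∂μ := by
    rw [lintegral_prod _ (by fun_prop)]
    refine lintegral_mono fun t => ?_
    refine (mul_le_mul_right (enorm_scalePairing_le_fourier hf hfc hφ hv t) _).trans ?_
    rw [← lintegral_const_mul' _ _ ENNReal.ofReal_ne_top]
    simp only [w, X, Y, mul_assoc, le_refl]
  have hIX : ∫⁻ p, w p * X p ^ 2 ∂μ ≤
      ENNReal.ofReal (2 ^ n * A * Real.pi) * ∫⁻ η, ‖𝓕 (toC φ) η‖ₑ ^ 2 := by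
    rw [lintegral_prod _ (by fun_prop)]
    have : ∀ t ∈ Set.Ioi (2 : ℝ), ∫⁻ ζ, w (t, ζ) * X (t, ζ) ^ 2 ≤
        ENNReal.ofReal (2 ^ n) * ∫⁻ ζ, ENNReal.ofReal ((t - 1) ^ (n - 1)) * ‖𝓕 (toC f) ζ‖ₑ *
          ‖𝓕 (toC φ) ((t - 1) • ζ)‖ₑ ^ 2 := by
      intro t ht
      have ht : 2 < t := ht
      rw [← lintegral_const_mul' _ _ ENNReal.ofReal_ne_top]
      refine lintegral_mono fun ζ => ?_
      simp only [w, X]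
      rw [← mul_assoc, ← mul_assoc, ← ENNReal.ofReal_mul (by positivity)]
      gcongr
      -- The transform of φ is dilated by t-1 rather than t, so the weight must be a power of t-1.
      -- Beyond 2 one has t ≤ 2(t-1); this is why the scales are cut there and where 2^n comes from.
      calc t ^ (n - 1) ≤ (2 * (t - 1)) ^ (n - 1) := by gcongr; linarith
        _ = 2 ^ (n - 1) * (t - 1) ^ (n - 1) := mul_pow _ _ _
        _ ≤ 2 ^ n * (t - 1) ^ (n - 1) := by
          have : 0 ≤ (t - 1) ^ (n - 1) := pow_nonneg (by linarith) _
          gcongr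
          · norm_num
          · omega
    refine (setLIntegral_mono' measurableSet_Ioi this).trans ?_
    rw [lintegral_const_mul' _ _ ENNReal.ofReal_ne_top, lintegral_Ioi_comp_sub_one
      (fun t => ∫⁻ ζ, ENNReal.ofReal (t ^ (n - 1)) * ‖𝓕 (toC f) ζ‖ₑ * ‖𝓕 (toC φ) (t • ζ)‖ₑ ^ 2),
      mul_assoc (2 ^ n), ENNReal.ofReal_mul (by positivity), mul_assoc]
    gcongr
    refine (lintegral_mono_set (Set.Ioi_subset_Ioi zero_le_one)).trans ?_
    exact lintegral_dilation_le hn hcf hA hρ hFA (H := fun η => ‖𝓕 (toC φ) η‖ₑ ^ 2)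
      (hcφ.measurable.enorm.pow_const 2)
  have hIY : ∫⁻ p, w p * Y p ^ 2 ∂μ ≤
      ENNReal.ofReal (2 ^ n * A * Real.pi) * ∫⁻ η, ‖𝓕 (toC v) η‖ₑ ^ 2 := by
    rw [lintegral_prod _ (by fun_prop)]
    refine (lintegral_mono_set (Set.Ioi_subset_Ioi zero_le_two)).trans ?_
    refine (lintegral_dilation_le hn hcf hA hρ hFA (H := fun η => ‖𝓕 (toC v) (-η)‖ₑ ^ 2)
      ((hcv.measurable.comp measurable_neg).enorm.pow_const 2)).trans ?_
    rw [lintegral_neg_eq_self (fun η => ‖𝓕 (toC v) η‖ₑ ^ 2)]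
    gcongr
    have : (1 : ℝ) ≤ 2 ^ n := one_le_pow₀ one_le_two
    nlinarith
  refine step.trans ((lintegral_mul_mul_le μ hw hX hY).trans ?_)
  calc _ ≤ (ENNReal.ofReal (2 ^ n * A * Real.pi) * ∫⁻ η, ‖𝓕 (toC φ) η‖ₑ ^ 2) ^ (1 / 2 : ℝ) *
        (ENNReal.ofReal (2 ^ n * A * Real.pi) * ∫⁻ η, ‖𝓕 (toC v) η‖ₑ ^ 2) ^ (1 / 2 : ℝ) := by
        gcongr
    _ = _ := by
        rw [ENNReal.mul_rpow_of_nonneg _ _ (by norm_num), ENNReal.mul_rpow_of_nonneg _ _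
          (by norm_num), lintegral_enorm_fourier_sq hφ hφ2, lintegral_enorm_fourier_sq hv hv2]
        set c := ENNReal.ofReal (2 ^ n * A * Real.pi)
        have : c ^ (1 / 2 : ℝ) * c ^ (1 / 2 : ℝ) = c := by
          rw [← ENNReal.rpow_add_of_nonneg _ _ (by norm_num) (by norm_num)]
          norm_num
        rw [mul_mul_mul_comm, this, mul_assoc]

end

end PoincareEstimate

/-! ### Fourier decay of derivatives -/

namespace PoincareEstimate

open MeasureTheory FourierTransform
open scoped ContDiff ENNReal

theorem fourier_fderiv_apply {n : ℕ} {h : E n → ℝ} (hh : ContDiff ℝ ∞ h)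
    (hc : HasCompactSupport h) (m ζ : E n) :
    𝓕 (toC fun x => fderiv ℝ h x m) ζ =
      (2 * Real.pi * Complex.I) * (inner ℝ ζ m * 𝓕 (toC h) ζ) := by
  have hc' : HasCompactSupport (toC h) := hc.comp_left Complex.ofReal_zero
  have hh' : ContDiff ℝ ∞ (toC h) := Complex.ofRealCLM.contDiff.comp hh
  set S : SchwartzMap (E n) ℂ := hc'.toSchwartzMap hh'
  have h1 := congrArg (fun T : SchwartzMap (E n) ℂ => T ζ) (SchwartzMap.fourier_lineDerivOp_eq S m)
  have h2 : (LineDeriv.lineDerivOp m S : E n → ℂ) = toC fun x => fderiv ℝ h x m := by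
    funext x
    rw [SchwartzMap.lineDerivOp_apply_eq_fderiv]
    have := (Complex.ofRealCLM.hasFDerivAt.comp x
      ((hh.differentiable (by simp)) x).hasFDerivAt).fderiv
    change fderiv ℝ (Complex.ofRealCLM ∘ h) x m = _
    rw [this]
    simp
  rw [← h2]
  refine h1.trans ?_
  rw [smul_apply, SchwartzMap.smulLeftCLM_apply_apply (by fun_prop)]
  simp only [smul_eq_mul, Complex.real_smul]
  rfl

theorem norm_fourier_le_integral {n : ℕ} (h : E n → ℝ) (ζ : E n) :
    ‖𝓕 (toC h) ζ‖ ≤ ∫ x, |h x| := by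
  refine (VectorFourier.norm_fourierIntegral_le_integral_norm _ _ _ _ _).trans_eq ?_
  simp

theorem norm_le_sum_abs {n : ℕ} (ζ : E n) : ‖ζ‖ ≤ ∑ i, |ζ i| := by
  rw [EuclideanSpace.norm_eq]
  refine Real.sqrt_le_iff.2 ⟨Finset.sum_nonneg fun i _ => abs_nonneg _, ?_⟩
  simpa using Finset.sum_sq_le_sq_sum_of_nonneg (s := Finset.univ) (f := fun i => |ζ i|)
    fun i _ => abs_nonneg _

/-- Decay at zero and at infinity of the Fourier transform of a derivative. -/
theorem norm_fourier_fderiv_le {n : ℕ} {h : E n → ℝ} (hh : ContDiff ℝ ∞ h)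
    (hc : HasCompactSupport h) (j : Fin n) {a b ρ : ℝ} (hρ : 0 < ρ) (ha : ∫ x, |h x| ≤ a)
    (hb : ∀ i, ∫ x, |fderiv ℝ (fun y => fderiv ℝ h y (e j)) x (e i)| ≤ b) (ζ : E n) :
    ‖𝓕 (toC fun x => fderiv ℝ h x (e j)) ζ‖ ≤
      (2 * Real.pi * a / ρ + n * b * ρ) * (ρ * ‖ζ‖ / (1 + (ρ * ‖ζ‖) ^ 2)) := by
  set f : E n → ℝ := fun x => fderiv ℝ h x (e j)
  have hf : ContDiff ℝ ∞ f := (hh.fderiv_right (by simp)).clm_apply contDiff_const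
  have hfc : HasCompactSupport f := hc.fderiv_apply (𝕜 := ℝ) _
  set F := ‖𝓕 (toC f) ζ‖
  have hi : ∀ i, |ζ i| = |inner ℝ ζ (e i)| := fun i => by simp [e, EuclideanSpace.inner_single_right]
  -- Low frequencies: the symbol of the derivative vanishes to first order at the origin.
  have h1 : F ≤ 2 * Real.pi * a * ‖ζ‖ := by
    simp only [F, f]
    rw [fourier_fderiv_apply hh hc]
    simp only [norm_mul, Complex.norm_real, Complex.norm_I, Complex.norm_ofNat, mul_one]
    have h2 := (norm_fourier_le_integral h ζ).trans ha
    have h3 : ‖(inner ℝ ζ (e j) : ℝ)‖ ≤ ‖ζ‖ := by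
      refine (norm_inner_le_norm _ _).trans ?_
      simp [e]
    rw [Real.norm_of_nonneg Real.pi_pos.le, mul_assoc (2 * Real.pi), mul_comm a]
    gcongr
  -- High frequencies: one more derivative in each direction i bounds |ζ_i| F by b, the factor 2π ≥
  -- 1 being dropped, and the sum over i dominates ‖ζ‖ F.
  have h2 : ‖ζ‖ * F ≤ n * b := by
    have h3 : ∀ i, |ζ i| * F ≤ b := by
      intro i
      have h4 := (norm_fourier_le_integral _ ζ).trans (hb i)
      rw [fourier_fderiv_apply hf hfc] at h4
      simp only [norm_mul, Complex.norm_real, Complex.norm_I, Complex.norm_ofNat, mul_one] at h4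
      rw [hi]
      refine le_trans ?_ h4
      rw [Real.norm_of_nonneg Real.pi_pos.le]
      have : (1 : ℝ) ≤ 2 * Real.pi := by linarith [Real.pi_gt_three]
      exact le_mul_of_one_le_left (by positivity) this
    calc ‖ζ‖ * F ≤ (∑ i, |ζ i|) * F := by
          gcongr
          exact norm_le_sum_abs ζ
      _ = ∑ i, |ζ i| * F := Finset.sum_mul _ _ _
      _ ≤ ∑ i : Fin n, b := Finset.sum_le_sum fun i _ => h3 i
      _ = n * b := by simp
  rw [← mul_div_assoc, le_div_iff₀ (by positivity)]
  -- Adding `h1` to ρ²‖ζ‖ times `h2` bounds F (1 + (ρ‖ζ‖)²).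
  have h3 : ρ ^ 2 * ‖ζ‖ * (‖ζ‖ * F) ≤ ρ ^ 2 * ‖ζ‖ * (n * b) := by gcongr
  have h4 : 2 * Real.pi * a / ρ * (ρ * ‖ζ‖) = 2 * Real.pi * a * ‖ζ‖ := by field_simp
  nlinarith

/-! ### Schur bounds at a fixed scale -/

section SmallScale

variable {n : ℕ}

theorem lintegral_enorm_comp_smul_sub {f : E n → ℝ} (hf : Measurable f) {t : ℝ} (ht : 0 < t)
    (z : E n) : ∫⁻ y, ‖f (t • y - z)‖ₑ = ENNReal.ofReal (t ^ n)⁻¹ * ∫⁻ y, ‖f y‖ₑ := by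
  rw [lintegral_comp_smul (f := fun y => ‖f (y - z)‖ₑ) (by fun_prop) ht,
    lintegral_sub_right_eq_self (fun y => ‖f y‖ₑ)]

theorem lintegral_enorm_comp_sub_smul {f : E n → ℝ} (hf : Measurable f) {t : ℝ} (ht : 0 < t)
    (z : E n) : ∫⁻ x, ‖f (z - t • x)‖ₑ = ENNReal.ofReal (t ^ n)⁻¹ * ∫⁻ y, ‖f y‖ₑ := by
  rw [lintegral_comp_smul (f := fun x => ‖f (z - x)‖ₑ) (by fun_prop) ht,
    lintegral_sub_left_eq_self (fun y => ‖f y‖ₑ)]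

/-- Schur-type bound for `scalePairing`. -/
theorem enorm_scalePairing_le {f φ v : E n → ℝ} (hf : Measurable f) (hφ : Measurable φ)
    (hv : Measurable v) {Ω : Set (E n)} (hΩ : MeasurableSet Ω) (hφΩ : ∀ x ∉ Ω, φ x = 0)
    {t : ℝ} (ht : 0 < t) {D : ℝ≥0∞}
    (hD : ∀ y, ∫⁻ x in Ω, ‖f (t • y - (t - 1) • x)‖ₑ ≤ D) :
    ‖scalePairing f φ v t‖ₑ ≤
      (ENNReal.ofReal (t ^ n)⁻¹ * (∫⁻ y, ‖f y‖ₑ) * D) ^ (1 / 2 : ℝ) *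
        (eLpNorm φ 2 volume * eLpNorm v 2 volume) := by
  set w : E n × E n → ℝ≥0∞ := fun p => ‖f (t • p.2 - (t - 1) • p.1)‖ₑ
  set X : E n × E n → ℝ≥0∞ := fun p => ‖φ p.1‖ₑ
  -- As φ vanishes off Ω, the indicator may be placed in the second factor, so that the x-marginal
  -- of the kernel is only taken over Ω.
  set Y : E n × E n → ℝ≥0∞ := fun p => Ω.indicator (fun _ => 1) p.1 * ‖v p.2‖ₑ
  have hw : Measurable w := by fun_prop
  have hX : Measurable X := by fun_prop
  have hY : Measurable Y :=
    ((measurable_const.indicator hΩ).comp measurable_fst).mul (by fun_prop)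
  have step : ‖scalePairing f φ v t‖ₑ ≤ ∫⁻ p, w p * (X p * Y p) := by
    refine (enorm_integral_le_lintegral_enorm _).trans (lintegral_mono fun p => ?_)
    simp only [w, X, Y, enorm_mul]
    by_cases hp : p.1 ∈ Ω
    · rw [Set.indicator_of_mem hp, one_mul, mul_comm]
    · simp [hφΩ _ hp]
  have hIX : ∫⁻ p, w p * X p ^ 2 ≤
      (ENNReal.ofReal (t ^ n)⁻¹ * ∫⁻ y, ‖f y‖ₑ) * ∫⁻ x, ‖φ x‖ₑ ^ 2 := by
    rw [Measure.volume_eq_prod, lintegral_prod _ (by fun_prop),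
      ← lintegral_const_mul _ (by fun_prop)]
    refine lintegral_mono fun x => ?_
    simp only [w, X]
    rw [lintegral_mul_const _ (by fun_prop), lintegral_enorm_comp_smul_sub hf ht]
  have hIY : ∫⁻ p, w p * Y p ^ 2 ≤ D * ∫⁻ x, ‖v x‖ₑ ^ 2 := by
    rw [Measure.volume_eq_prod, lintegral_prod_symm _ (by fun_prop),
      ← lintegral_const_mul _ (by fun_prop)]
    refine lintegral_mono fun y => ?_
    refine le_trans ?_ (mul_le_mul_left (hD y) _)
    rw [← lintegral_mul_const _ (by fun_prop), ← lintegral_indicator hΩ]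
    refine lintegral_mono fun x => ?_
    by_cases hx : x ∈ Ω
    · simp [w, Y, hx]
    · simp [w, Y, hx]
  refine step.trans ((lintegral_mul_mul_le _ hw hX hY).trans ?_)
  calc _ ≤ ((ENNReal.ofReal (t ^ n)⁻¹ * ∫⁻ y, ‖f y‖ₑ) * ∫⁻ x, ‖φ x‖ₑ ^ 2) ^ (1 / 2 : ℝ) *
        (D * ∫⁻ x, ‖v x‖ₑ ^ 2) ^ (1 / 2 : ℝ) := by gcongr
    _ = _ := by
        rw [eLpNorm_two_eq_lintegral, eLpNorm_two_eq_lintegral]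
        simp only [ENNReal.mul_rpow_of_nonneg _ _ (show (0 : ℝ) ≤ 1 / 2 by norm_num)]
        ring

theorem ofReal_rpow_half {a : ℝ} (ha : 0 ≤ a) :
    (ENNReal.ofReal a) ^ (1 / 2 : ℝ) = ENNReal.ofReal √a := by
  rw [ENNReal.ofReal_rpow_of_nonneg ha (by norm_num), Real.sqrt_eq_rpow]

/-- Both marginals are computed over the whole space by a linear change of variables, with Jacobians
t^n and (t-1)^n; their geometric mean enters the Schur test. -/
theorem enorm_scalePairing_le_of_l1 {f φ v : E n → ℝ} (hf : Measurable f) (hφ : Measurable φ)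
    (hv : Measurable v) {N : ℝ} (hN : 0 ≤ N) (hfN : ∫⁻ y, ‖f y‖ₑ ≤ ENNReal.ofReal N)
    {t : ℝ} (ht : 1 < t) :
    ‖scalePairing f φ v t‖ₑ ≤ ENNReal.ofReal (N * √((t ^ n)⁻¹ * ((t - 1) ^ n)⁻¹)) *
        (eLpNorm φ 2 volume * eLpNorm v 2 volume) := by
  have ht1 : 0 < t - 1 := by linarith
  have ht0 : 0 < t := by linarith
  have hD : ∀ y, ∫⁻ x in Set.univ, ‖f (t • y - (t - 1) • x)‖ₑ ≤
      ENNReal.ofReal (((t - 1) ^ n)⁻¹ * N) := fun y => by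
    rw [setLIntegral_univ, lintegral_enorm_comp_sub_smul hf ht1, ENNReal.ofReal_mul (by positivity)]
    gcongr
  refine (enorm_scalePairing_le hf hφ hv MeasurableSet.univ (by simp) ht0 hD).trans ?_
  gcongr
  calc _ ≤ (ENNReal.ofReal (t ^ n)⁻¹ * ENNReal.ofReal N *
        ENNReal.ofReal (((t - 1) ^ n)⁻¹ * N)) ^ (1 / 2 : ℝ) := by gcongr
    _ = _ := by
      rw [← ENNReal.ofReal_mul (by positivity), ← ENNReal.ofReal_mul (by positivity),
        ofReal_rpow_half (by positivity)]
      congr 1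
      rw [show (t ^ n)⁻¹ * N * (((t - 1) ^ n)⁻¹ * N) = N ^ 2 * ((t ^ n)⁻¹ * ((t - 1) ^ n)⁻¹) by ring,
        Real.sqrt_mul (by positivity), Real.sqrt_sq hN]

/-- The change of variables in x degenerates as t → 1, so the x-marginal is instead bounded by the
sup norm of f times |Ω|. The result stays bounded down to t = 1. -/
theorem enorm_scalePairing_le_of_sup {f φ v : E n → ℝ} (hf : Measurable f) (hφ : Measurable φ)
    (hv : Measurable v) {Ω : Set (E n)} (hΩ : MeasurableSet Ω) (hφΩ : ∀ x ∉ Ω, φ x = 0)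
    {N Q : ℝ} (hN : 0 ≤ N) (hQ : 0 ≤ Q) (hfN : ∫⁻ y, ‖f y‖ₑ ≤ ENNReal.ofReal N)
    (hfQ : ∀ y, ‖f y‖ₑ * volume Ω ≤ ENNReal.ofReal (N * Q)) {t : ℝ} (ht : 1 < t) :
    ‖scalePairing f φ v t‖ₑ ≤ ENNReal.ofReal (N * √Q) *
        (eLpNorm φ 2 volume * eLpNorm v 2 volume) := by
  have ht1 : 0 < t - 1 := by linarith
  have ht0 : 0 < t := by linarith
  have hD : ∀ y, ∫⁻ x in Ω, ‖f (t • y - (t - 1) • x)‖ₑ ≤ ENNReal.ofReal (N * Q) := fun y => by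
    rcases eq_or_ne (volume Ω) 0 with h0 | h0
    · rw [Measure.restrict_eq_zero.2 h0]
      simp
    -- Infinite volume forces f = 0 through `hfQ`; otherwise `hfQ` can be divided by the volume.
    · by_cases htop : volume Ω = ⊤
      · have : ∀ z, ‖f z‖ₑ = 0 := fun z => by
          by_contra hz
          have := hfQ z
          rw [htop, ENNReal.mul_top hz] at this
          simp at this
        simp [this]
      · have : ∀ z, ‖f z‖ₑ ≤ ENNReal.ofReal (N * Q) / volume Ω := fun z =>
          (ENNReal.le_div_iff_mul_le (.inl h0) (.inl htop)).2 (hfQ z)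
        refine (lintegral_mono fun x => this _).trans ?_
        rw [setLIntegral_const]
        exact ENNReal.mul_le_of_le_div le_rfl
  refine (enorm_scalePairing_le hf hφ hv hΩ hφΩ ht0 hD).trans ?_
  gcongr
  calc _ ≤ (ENNReal.ofReal 1 * ENNReal.ofReal N * ENNReal.ofReal (N * Q)) ^ (1 / 2 : ℝ) := by
        gcongr
        exact inv_le_one_of_one_le₀ (one_le_pow₀ ht.le)
    _ = _ := by
      rw [← ENNReal.ofReal_mul (by positivity), ← ENNReal.ofReal_mul (by positivity),
        ofReal_rpow_half (by positivity)]
      congr 1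
      rw [show 1 * N * (N * Q) = N ^ 2 * Q by ring,
        Real.sqrt_mul (by positivity), Real.sqrt_sq hN]

end SmallScale

end PoincareEstimate

/-! ### The factor κ and the integral over small scales -/

namespace PoincareEstimate

open MeasureTheory FourierTransform
open scoped ContDiff ENNReal

theorem setLIntegral_Ioc_ofReal {f : ℝ → ℝ} {a b : ℝ} (hab : a ≤ b)
    (hf : IntervalIntegrable f volume a b) (h0 : ∀ x ∈ Set.Ioc a b, 0 ≤ f x) :
    ∫⁻ x in Set.Ioc a b, ENNReal.ofReal (f x) = ENNReal.ofReal (∫ x in a..b, f x) := by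
  rw [intervalIntegral.integral_of_le hab, ofReal_integral_eq_lintegral_ofReal
    ((intervalIntegrable_iff_integrableOn_Ioc_of_le hab).1 hf)
    ((ae_restrict_iff' measurableSet_Ioc).2 (.of_forall h0))]

theorem inv_sqrt_pow_eq_rpow {σ : ℝ} (hσ : 0 < σ) (n : ℕ) : (√(σ ^ n))⁻¹ = σ ^ (-(n / 2 : ℝ)) := by
  rw [Real.rpow_neg hσ.le, Real.sqrt_eq_rpow, ← Real.rpow_natCast, ← Real.rpow_mul hσ.le]
  congr 2
  ring

/-- If log q ≥ 1, the logarithmic factor is at least one and the larger exponent wins; if log q ≤ 1,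
then q ≤ e < 3, whence the constant. -/
theorem rpow_le_three_mul_kappa_aux {q a a' b : ℝ} (hq : 1 ≤ q) (haa : a' ≤ a) (ha' : a' ≤ 1)
    (hb : 0 ≤ b) : q ^ a' ≤ 3 * (1 + q ^ a * Real.log q ^ b) := by
  have hlog : 0 ≤ Real.log q := Real.log_nonneg hq
  have hpos : 0 ≤ q ^ a * Real.log q ^ b := by positivity
  rcases le_total 1 (Real.log q) with h | h
  · have h1 : q ^ a' ≤ q ^ a := Real.rpow_le_rpow_of_exponent_le hq haa
    have h2 : 1 ≤ Real.log q ^ b := Real.one_le_rpow h hb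
    have h3 : q ^ a ≤ q ^ a * Real.log q ^ b := le_mul_of_one_le_right (by positivity) h2
    linarith
  · have h1 : q ≤ Real.exp 1 := by
      rwa [← Real.log_le_iff_le_exp (by linarith)]
    have h2 : q ^ a' ≤ q ^ (1 : ℝ) := Real.rpow_le_rpow_of_exponent_le hq ha'
    rw [Real.rpow_one] at h2
    linarith [Real.exp_one_lt_d9]

theorem one_le_kappa (n ℓ : ℕ) {q : ℝ} (hq : 1 ≤ q) : 1 ≤ kappa n ℓ q := by
  have hlog : 0 ≤ Real.log q := Real.log_nonneg hq
  unfold kappa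
  split_ifs
  · exact le_rfl
  all_goals exact le_add_of_nonneg_right (by positivity)

/-- The left side is the power produced by the small scales. Its exponent is (n-2ℓ)/(2n), at most
the exponent (n-2ℓ)/(2(n-ℓ)) in κ, so κ dominates it whichever logarithmic power it carries. -/
theorem rpow_le_three_mul_kappa {n ℓ : ℕ} {q : ℝ} (hq : 1 ≤ q) (hℓ : 1 ≤ ℓ) (h : 2 * ℓ ≤ n) :
    q ^ (1 / 2 - ℓ / n : ℝ) ≤ 3 * kappa n ℓ q := by
  have hR : 2 * (ℓ : ℝ) ≤ n := by exact_mod_cast h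
  have hℓR : 1 ≤ (ℓ : ℝ) := by exact_mod_cast hℓ
  have hn : 0 < (n : ℝ) := by linarith
  have hnl : 0 < (n : ℝ) - ℓ := by linarith
  have e1 : (1 / 2 - ℓ / n : ℝ) ≤ ((n : ℝ) - 2 * ℓ) / (2 * ((n : ℝ) - ℓ)) := by
    have : (1 / 2 - ℓ / n : ℝ) = ((n : ℝ) - 2 * ℓ) / (2 * n) := by field_simp
    rw [this]
    gcongr
    linarith
  have e2 : (1 / 2 - ℓ / n : ℝ) ≤ 1 := by
    have : 0 ≤ (ℓ / n : ℝ) := by positivity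
    linarith
  unfold kappa
  rw [if_neg (by omega)]
  split_ifs with h2
  · exact rpow_le_three_mul_kappa_aux hq e1 e2 (by positivity)
  · refine rpow_le_three_mul_kappa_aux hq e1 e2 ?_
    have : (2 * (ℓ : ℝ) + 1) ≤ n := by
      have : 2 * ℓ + 1 ≤ n := by omega
      exact_mod_cast this
    have : 0 ≤ (n : ℝ) - ℓ - 1 := by linarith
    positivity

/-- At 2ℓ = n the exponent of q in κ is zero and that of the logarithm is one. -/
theorem one_add_log_eq_kappa {n ℓ : ℕ} {q : ℝ} (hℓ : 1 ≤ ℓ) (h : 2 * ℓ = n) :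
    1 + Real.log q = kappa n ℓ q := by
  have hR : 2 * (ℓ : ℝ) = n := by exact_mod_cast h
  have hℓR : 1 ≤ (ℓ : ℝ) := by exact_mod_cast hℓ
  unfold kappa
  rw [if_neg (by omega), if_pos (by omega), ← hR, sub_self, zero_div, Real.rpow_zero, one_mul,
    show (2 * (ℓ : ℝ)) / (2 * (2 * ℓ - ℓ)) = 1 by field_simp; ring, Real.rpow_one]

/-- The contribution of the small scales is controlled by `kappa`. -/
theorem exists_lintegral_min_le_kappa (n k : ℕ) (hn : 1 ≤ n) (c : ℝ) (hc : 0 ≤ c) :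
    ∃ C : ℝ, 0 ≤ C ∧ ∀ q Q : ℝ, 1 ≤ q → Q ≤ c * q →
      ∫⁻ σ in Set.Ioc (0 : ℝ) 1, ENNReal.ofReal (σ ^ k * min (√(σ ^ n))⁻¹ √Q) ≤
        ENNReal.ofReal (C * kappa n (k + 1) q) := by
  have hn0 : (0 : ℝ) < n := by exact_mod_cast hn
  have hpow : ∀ σ ∈ Set.Ioc (0 : ℝ) 1, σ ^ k * (√(σ ^ n))⁻¹ = σ ^ ((k : ℝ) - n / 2) := by
    intro σ hσ
    rw [inv_sqrt_pow_eq_rpow hσ.1, ← Real.rpow_natCast, ← Real.rpow_add hσ.1, sub_eq_add_neg]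
  -- Here ℓ = k + 1. For 2ℓ > n the power σ^{k-n/2} is integrable at the origin, and the bound √Q is
  -- not needed.
  by_cases hcase : n < 2 * (k + 1)
  · have hcR : (n : ℝ) < 2 * (k + 1) := by exact_mod_cast hcase
    have hp : -1 < (k : ℝ) - n / 2 := by linarith
    refine ⟨((k : ℝ) - n / 2 + 1)⁻¹, inv_nonneg.2 (by linarith), fun q Q hq hQ => ?_⟩
    have hk : kappa n (k + 1) q = 1 := by rw [kappa, if_pos hcase]
    calc _ ≤ ∫⁻ σ in Set.Ioc (0 : ℝ) 1, ENNReal.ofReal (σ ^ ((k : ℝ) - n / 2)) := by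
          refine setLIntegral_mono' measurableSet_Ioc fun σ hσ => ENNReal.ofReal_le_ofReal ?_
          rw [← hpow σ hσ]
          have := hσ.1
          gcongr
          exact min_le_left _ _
      _ ≤ _ := by
          rw [setLIntegral_Ioc_ofReal zero_le_one (intervalIntegral.intervalIntegrable_rpow' hp)
            (fun x hx => Real.rpow_nonneg hx.1.le _), integral_rpow (.inl hp), hk]
          rw [Real.one_rpow, Real.zero_rpow (by linarith)]
          simp
  push Not at hcase
  have hcR : 2 * ((k : ℝ) + 1) ≤ n := by exact_mod_cast hcase
  have hsplit : ∀ q Q : ℝ, 1 ≤ q → Q ≤ c * q →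
      ∫⁻ σ in Set.Ioc (0 : ℝ) 1, ENNReal.ofReal (σ ^ k * min (√(σ ^ n))⁻¹ √Q) ≤
        ENNReal.ofReal (3 * √c * kappa n (k + 1) q) +
        ENNReal.ofReal (∫ σ in (q ^ (-(1 / n : ℝ)))..1, σ ^ ((k : ℝ) - n / 2)) := by
    intro q Q hq hQ
    have hq0 : 0 < q := by linarith
    -- At σ = s the two bounds balance, up to constants: s^{-n/2} = √q. Below s the bound √Q
    -- contributes at most a multiple of s^ℓ √q = q^{1/2-ℓ/n}.
    set s := q ^ (-(1 / n : ℝ)) with hs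
    have hs0 : 0 < s := by positivity
    have hs1 : s ≤ 1 := Real.rpow_le_one_of_one_le_of_nonpos hq
      (by rw [neg_nonpos]; positivity)
    rw [← Set.Ioc_union_Ioc_eq_Ioc hs0.le hs1,
      lintegral_union measurableSet_Ioc (Set.Ioc_disjoint_Ioc_of_le le_rfl)]
    gcongr
    · calc _ ≤ ∫⁻ σ in Set.Ioc (0 : ℝ) s, ENNReal.ofReal (σ ^ k * √(c * q)) := by
            refine setLIntegral_mono' measurableSet_Ioc fun σ hσ => ENNReal.ofReal_le_ofReal ?_
            have := hσ.1
            gcongr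
            exact (min_le_right _ _).trans (Real.sqrt_le_sqrt hQ)
        _ ≤ _ := by
            rw [setLIntegral_Ioc_ofReal hs0.le (Continuous.intervalIntegrable (by fun_prop) _ _)
              (fun x hx => mul_nonneg (pow_nonneg hx.1.le _) (Real.sqrt_nonneg _)),
              intervalIntegral.integral_mul_const, integral_pow]
            refine ENNReal.ofReal_le_ofReal ?_
            have e1 : s ^ (k + 1) * √q = q ^ (1 / 2 - ((k + 1 : ℕ) : ℝ) / n : ℝ) := by
              rw [hs, ← Real.rpow_natCast, ← Real.rpow_mul hq0.le, Real.sqrt_eq_rpow,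
                ← Real.rpow_add hq0]
              congr 1
              field_simp
              ring
            have e2 := rpow_le_three_mul_kappa hq (Nat.le_add_left 1 k) hcase
            rw [← e1] at e2
            have e3 : (s ^ (k + 1) - 0 ^ (k + 1)) / ((k : ℝ) + 1) ≤ s ^ (k + 1) := by
              rw [zero_pow (by omega), sub_zero]
              exact div_le_self (by positivity) (by linarith [(Nat.cast_nonneg k : (0 : ℝ) ≤ k)])
            rw [Real.sqrt_mul hc]
            calc _ ≤ s ^ (k + 1) * (√c * √q) := by gcongr
              _ = √c * (s ^ (k + 1) * √q) := by ring
              _ ≤ √c * (3 * kappa n (k + 1) q) := by gcongr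
              _ = _ := by ring
    · calc _ ≤ ∫⁻ σ in Set.Ioc s 1, ENNReal.ofReal (σ ^ ((k : ℝ) - n / 2)) := by
            refine setLIntegral_mono' measurableSet_Ioc fun σ hσ => ENNReal.ofReal_le_ofReal ?_
            have := hs0.trans hσ.1
            rw [← hpow σ ⟨this, hσ.2⟩]
            gcongr
            exact min_le_left _ _
        _ ≤ _ := by
            rw [setLIntegral_Ioc_ofReal hs1 _ (fun x hx => Real.rpow_nonneg (hs0.trans hx.1).le _)]
            refine intervalIntegral.intervalIntegrable_rpow (.inr ?_)
            rw [Set.uIcc_of_le hs1]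
            exact fun h => absurd h.1 (not_le.2 hs0)
  suffices h : ∃ C : ℝ, 0 ≤ C ∧ ∀ q : ℝ, 1 ≤ q →
      ∫ σ in (q ^ (-(1 / n : ℝ)))..1, σ ^ ((k : ℝ) - n / 2) ≤ C * kappa n (k + 1) q by
    obtain ⟨C, hC, h⟩ := h
    refine ⟨3 * √c + C, by positivity, fun q Q hq hQ => (hsplit q Q hq hQ).trans ?_⟩
    have hκ := one_le_kappa n (k + 1) hq
    rw [add_mul, ENNReal.ofReal_add (by positivity) (by positivity)]
    gcongr
    exact h q hq
  -- For 2ℓ = n the exponent is -1 and the integral is log q / n; for 2ℓ < n the lower endpoint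
  -- dominates, with s^{ℓ-n/2} = q^{1/2-ℓ/n}.
  rcases hcase.eq_or_lt with heq | hlt
  · refine ⟨1, zero_le_one, fun q hq => ?_⟩
    have hq0 : 0 < q := by linarith
    have e0 : (k : ℝ) - n / 2 = -1 := by
      rw [← heq]
      push_cast
      ring
    have e1 : ∫ σ in (q ^ (-(1 / n : ℝ)))..1, σ ^ ((k : ℝ) - n / 2) = Real.log q / n := by
      simp only [e0, Real.rpow_neg_one]
      rw [integral_inv_of_pos (by positivity) one_pos, one_div, Real.log_inv,
        Real.log_rpow hq0]
      ring
    have e2 := one_add_log_eq_kappa (q := q) (Nat.le_add_left 1 k) heq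
    have e3 : Real.log q / n ≤ Real.log q := div_le_self (Real.log_nonneg hq)
      (by exact_mod_cast hn)
    rw [e1]
    linarith
  · have hltR : 2 * ((k : ℝ) + 1) < n := by exact_mod_cast hlt
    have hd : 0 < (n : ℝ) / 2 - (k + 1) := by linarith
    refine ⟨3 * ((n : ℝ) / 2 - (k + 1))⁻¹, by positivity, fun q hq => ?_⟩
    have hq0 : 0 < q := by linarith
    have hs1 : q ^ (-(1 / n : ℝ)) ≤ 1 := Real.rpow_le_one_of_one_le_of_nonpos hq
      (by rw [neg_nonpos]; positivity)
    have hs0 : 0 < q ^ (-(1 / n : ℝ)) := by positivity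
    rw [integral_rpow (.inr ⟨by linarith, by
      rw [Set.uIcc_of_le hs1]
      exact fun h => absurd h.1 (not_le.2 hs0)⟩), Real.one_rpow, ← Real.rpow_mul hq0.le]
    have e1 : -(1 / n : ℝ) * ((k : ℝ) - n / 2 + 1) = 1 / 2 - ((k + 1 : ℕ) : ℝ) / n := by
      push_cast
      field_simp
      ring
    rw [e1, ← neg_div_neg_eq, show -((k : ℝ) - n / 2 + 1) = (n : ℝ) / 2 - (k + 1) by ring,
      div_eq_inv_mul]
    have e2 := rpow_le_three_mul_kappa hq (Nat.le_add_left 1 k) hcase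
    calc _ ≤ ((n : ℝ) / 2 - (k + 1))⁻¹ * (3 * kappa n (k + 1) q) := by
          gcongr
          linarith
      _ = _ := by ring

end PoincareEstimate

/-! ### Integration over all scales -/

namespace PoincareEstimate

open MeasureTheory FourierTransform
open scoped ContDiff ENNReal

theorem lintegral_Ioc_comp_sub_one (g : ℝ → ℝ≥0∞) :
    ∫⁻ t in Set.Ioc (1 : ℝ) 2, g (t - 1) = ∫⁻ t in Set.Ioc (0 : ℝ) 1, g t := by
  rw [← lintegral_indicator measurableSet_Ioc, ← lintegral_indicator measurableSet_Ioc,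
    ← lintegral_sub_right_eq_self ((Set.Ioc (0 : ℝ) 1).indicator g) (1 : ℝ)]
  refine lintegral_congr fun t => ?_
  have : t ∈ Set.Ioc (1 : ℝ) 2 ↔ t - 1 ∈ Set.Ioc (0 : ℝ) 1 := by
    simp only [Set.mem_Ioc]
    constructor <;> rintro ⟨h, h'⟩ <;> constructor <;> linarith
  by_cases h : t - 1 ∈ Set.Ioc (0 : ℝ) 1
  · rw [Set.indicator_of_mem h, Set.indicator_of_mem (this.2 h)]
  · rw [Set.indicator_of_notMem h, Set.indicator_of_notMem (fun h' => h (this.1 h'))]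

/-- The two Schur bounds together give N min(σ^{-n/2}, √Q) with σ = t-1. The weight enters only
through its upper bound, so the estimate serves both with and without the extra factor t-1. -/
theorem exists_lintegral_scalePairing_small_le (n k : ℕ) (hn : 1 ≤ n) (c : ℝ) (hc : 0 ≤ c) :
    ∃ C : ℝ, 0 ≤ C ∧ ∀ (Ω : Set (E n)) (q Q N : ℝ) (f φ v : E n → ℝ) (w : ℝ → ℝ),
      MeasurableSet Ω → 1 ≤ q → 0 ≤ Q → Q ≤ c * q → 0 ≤ N →
      Measurable f → Measurable φ → Measurable v → (∀ x ∉ Ω, φ x = 0) →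
      ∫⁻ y, ‖f y‖ₑ ≤ ENNReal.ofReal N →
      (∀ y, ‖f y‖ₑ * volume Ω ≤ ENNReal.ofReal (N * Q)) →
      (∀ t ∈ Set.Ioc (1 : ℝ) 2, w t ≤ 2 ^ n * (t - 1) ^ k) →
      ∫⁻ t in Set.Ioc (1 : ℝ) 2, ENNReal.ofReal (w t) * ‖scalePairing f φ v t‖ₑ ≤
        ENNReal.ofReal (C * N * kappa n (k + 1) q) *
          (eLpNorm φ 2 volume * eLpNorm v 2 volume) := by
  obtain ⟨C, hC, h⟩ := exists_lintegral_min_le_kappa n k hn c hc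
  refine ⟨2 ^ n * C, by positivity, ?_⟩
  intro Ω q Q N f φ v w hΩ hq hQ hQq hN hf hφ hv hφΩ hfN hfQ hw
  set X := eLpNorm φ 2 volume * eLpNorm v 2 volume
  calc _ ≤ ∫⁻ t in Set.Ioc (1 : ℝ) 2, ENNReal.ofReal (2 ^ n * N) *
        (ENNReal.ofReal ((t - 1) ^ k * min (√((t - 1) ^ n))⁻¹ √Q)) * X := by
        refine setLIntegral_mono' measurableSet_Ioc fun t ht => ?_
        have ht0 : 0 < t - 1 := by linarith [ht.1]
        have h1 : ‖scalePairing f φ v t‖ₑ ≤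
            ENNReal.ofReal (N * min (√((t - 1) ^ n))⁻¹ √Q) * X := by
          rcases min_choice (√((t - 1) ^ n))⁻¹ √Q with h' | h' <;> rw [h']
          · refine (enorm_scalePairing_le_of_l1 hf hφ hv hN hfN ht.1).trans ?_
            gcongr
            rw [← Real.sqrt_inv]
            refine Real.sqrt_le_sqrt (mul_le_of_le_one_left (by positivity) ?_)
            exact inv_le_one_of_one_le₀ (one_le_pow₀ ht.1.le)
          · exact enorm_scalePairing_le_of_sup hf hφ hv hΩ hφΩ hN hQ hfN hfQ ht.1
        calc _ ≤ ENNReal.ofReal (2 ^ n * (t - 1) ^ k) *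
              (ENNReal.ofReal (N * min (√((t - 1) ^ n))⁻¹ √Q) * X) := by
              gcongr
              exact hw t ht
          _ = _ := by
              rw [← mul_assoc, ← ENNReal.ofReal_mul (by positivity),
                ← ENNReal.ofReal_mul (by positivity)]
              congr 2
              ring
    _ = ENNReal.ofReal (2 ^ n * N) * (∫⁻ σ in Set.Ioc (0 : ℝ) 1,
        ENNReal.ofReal (σ ^ k * min (√(σ ^ n))⁻¹ √Q)) * X := by
        rw [lintegral_mul_const _ (by fun_prop), lintegral_const_mul _ (by fun_prop),
          lintegral_Ioc_comp_sub_one (fun t => ENNReal.ofReal (t ^ k * min (√(t ^ n))⁻¹ √Q))]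
    _ ≤ ENNReal.ofReal (2 ^ n * N) * ENNReal.ofReal (C * kappa n (k + 1) q) * X := by
        gcongr
        exact h q Q hq hQq
    _ = _ := by
        rw [← ENNReal.ofReal_mul (by positivity)]
        congr 2
        ring

theorem lintegral_inv_sq_Ioi_two_le :
    ∫⁻ t in Set.Ioi (2 : ℝ), ENNReal.ofReal (t ^ 2)⁻¹ ≤ 1 := by
  have h := integrableOn_Ioi_rpow_of_lt (a := -2) (by norm_num) (zero_lt_two' ℝ)
  have h2 := integral_Ioi_rpow_of_lt (a := -2) (by norm_num) (zero_lt_two' ℝ)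
  have : ∀ t ∈ Set.Ioi (2 : ℝ), ENNReal.ofReal (t ^ 2)⁻¹ = ENNReal.ofReal (t ^ (-2 : ℝ)) := by
    intro t ht
    have : (0 : ℝ) < t := lt_trans two_pos ht
    rw [Real.rpow_neg this.le]
    norm_cast
  rw [setLIntegral_congr_fun measurableSet_Ioi this, ← ofReal_integral_eq_lintegral_ofReal h
    ((ae_restrict_iff' measurableSet_Ioi).2 (.of_forall fun t ht =>
      Real.rpow_nonneg (lt_trans two_pos ht).le _)), h2]
  rw [← ENNReal.ofReal_one]
  refine ENNReal.ofReal_le_ofReal ?_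
  norm_num [Real.rpow_neg_one]

/-- The weight `(t-1)^k t^(n-k-1) / t` of the scale `t`. -/
noncomputable def scaleWeight (n k : ℕ) (t : ℝ) : ℝ := (t - 1) ^ k * t ^ (n - k - 1) / t

theorem scaleWeight_nonneg {n k : ℕ} {t : ℝ} (ht : 1 < t) : 0 ≤ scaleWeight n k t := by
  have : 0 < t - 1 := by linarith
  have : 0 < t := by linarith
  unfold scaleWeight
  positivity

theorem scaleWeight_le_small {n k : ℕ} {t : ℝ} (ht : t ∈ Set.Ioc (1 : ℝ) 2) :
    scaleWeight n k t ≤ 2 ^ n * (t - 1) ^ k := by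
  have h0 : 0 < t - 1 := by linarith [ht.1]
  have h1 : t ^ (n - k - 1) ≤ 2 ^ n :=
    (pow_le_pow_right₀ ht.1.le (by omega)).trans (pow_le_pow_left₀ (by linarith) ht.2 n)
  unfold scaleWeight
  have : 0 < t := by linarith
  rw [mul_comm]
  exact (div_le_self (by positivity) ht.1.le).trans (by gcongr)

theorem scaleWeight_mul_le {n k : ℕ} (hk : k + 1 ≤ n) {t : ℝ} (ht : 1 < t) :
    scaleWeight n k t * t ≤ t ^ (n - 1) := by
  have h0 : 0 < t - 1 := by linarith
  have h1 : 0 < t := by linarith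
  rw [scaleWeight, div_mul_cancel₀ _ h1.ne', show n - 1 = k + (n - k - 1) by omega, pow_add]
  gcongr
  linarith

/-- Without the extra factor t-1 the weight is at most t^{n-2}, so for t > 2 the L¹ Schur bound
leaves an integrable t^{-2}: no cancellation in f is needed. -/
theorem exists_lintegral_weight_scalePairing_le (n k : ℕ) (hk : k + 1 ≤ n) (c : ℝ) (hc : 0 ≤ c) :
    ∃ C : ℝ, 0 ≤ C ∧ ∀ (Ω : Set (E n)) (q Q N : ℝ) (f φ v : E n → ℝ),
      MeasurableSet Ω → 1 ≤ q → 0 ≤ Q → Q ≤ c * q → 0 ≤ N →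
      Measurable f → Measurable φ → Measurable v → (∀ x ∉ Ω, φ x = 0) →
      ∫⁻ y, ‖f y‖ₑ ≤ ENNReal.ofReal N →
      (∀ y, ‖f y‖ₑ * volume Ω ≤ ENNReal.ofReal (N * Q)) →
      ∫⁻ t in Set.Ioi (1 : ℝ), ENNReal.ofReal (scaleWeight n k t) * ‖scalePairing f φ v t‖ₑ ≤
        ENNReal.ofReal (C * N * kappa n (k + 1) q) *
          (eLpNorm φ 2 volume * eLpNorm v 2 volume) := by
  obtain ⟨C, hC, h⟩ := exists_lintegral_scalePairing_small_le n k (by omega) c hc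
  refine ⟨C + 2 ^ n, by positivity, ?_⟩
  intro Ω q Q N f φ v hΩ hq hQ hQq hN hf hφ hv hφΩ hfN hfQ
  set X := eLpNorm φ 2 volume * eLpNorm v 2 volume
  have hκ := one_le_kappa n (k + 1) hq
  rw [← Set.Ioc_union_Ioi_eq_Ioi (one_le_two (α := ℝ)),
    lintegral_union measurableSet_Ioi (Set.Ioc_disjoint_Ioi le_rfl), add_mul, add_mul,
    ENNReal.ofReal_add (by positivity) (by positivity), add_mul]
  gcongr
  · exact h Ω q Q N f φ v _ hΩ hq hQ hQq hN hf hφ hv hφΩ hfN hfQ fun t ht => scaleWeight_le_small ht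
  · calc _ ≤ ∫⁻ t in Set.Ioi (2 : ℝ), ENNReal.ofReal (2 ^ n * N) * ENNReal.ofReal (t ^ 2)⁻¹ * X := by
          refine setLIntegral_mono' measurableSet_Ioi fun t ht => ?_
          have ht : 2 < t := ht
          refine (mul_le_mul_right (enorm_scalePairing_le_of_l1 hf hφ hv hN hfN
            (by linarith : 1 < t)) _).trans ?_
          rw [← mul_assoc, ← ENNReal.ofReal_mul (scaleWeight_nonneg (by linarith)),
            ← ENNReal.ofReal_mul (by positivity)]
          refine mul_le_mul_left (ENNReal.ofReal_le_ofReal ?_) _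
          have h0 : 0 < t - 1 := by linarith
          have h1 : √((t ^ n)⁻¹ * ((t - 1) ^ n)⁻¹) ≤ 2 ^ n * (t ^ n)⁻¹ := by
            refine Real.sqrt_le_iff.2 ⟨by positivity, ?_⟩
            have : ((t - 1) ^ n)⁻¹ ≤ 2 ^ n * (t ^ n)⁻¹ := by
              rw [← div_eq_mul_inv, ← div_pow, ← inv_pow]
              gcongr
              rw [inv_le_comm₀ h0 (by positivity), inv_div]
              linarith
            have h2 : (1 : ℝ) ≤ 2 ^ n := one_le_pow₀ one_le_two
            calc _ ≤ (2 ^ n * (t ^ n)⁻¹) * (2 ^ n * (t ^ n)⁻¹) := by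
                  gcongr
                  exact le_mul_of_one_le_left (by positivity) h2
              _ = _ := by ring
          have h2 := scaleWeight_mul_le hk (by linarith : 1 < t)
          have h3 : scaleWeight n k t ≤ t ^ (n - 1) / t := by
            rwa [le_div_iff₀ (by linarith)]
          calc _ ≤ t ^ (n - 1) / t * (N * (2 ^ n * (t ^ n)⁻¹)) := by
                gcongr
            _ = _ := by
                have : t ^ n = t ^ (n - 1) * t := by rw [← pow_succ]; congr 1; omega
                rw [this]
                field_simp
      _ = ENNReal.ofReal (2 ^ n * N) * (∫⁻ t in Set.Ioi (2 : ℝ), ENNReal.ofReal (t ^ 2)⁻¹) * X := by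
          rw [lintegral_mul_const _ (by fun_prop), lintegral_const_mul _ (by fun_prop)]
      _ ≤ ENNReal.ofReal (2 ^ n * N) * 1 * X := by
          gcongr
          exact lintegral_inv_sq_Ioi_two_le
      _ ≤ _ := by
          rw [mul_one]
          refine mul_le_mul_left (ENNReal.ofReal_le_ofReal ?_) _
          exact le_mul_of_one_le_right (by positivity) hκ

/-- With the extra factor t-1 the Schur bound leaves 1/t at infinity, so for t > 2 the Fourier
estimate takes over. N measures the L¹ and sup norms of f for the small scales, A ≥ N its Fourier
decay for the large ones. -/
theorem exists_lintegral_weight_mul_scalePairing_le (n k : ℕ) (hk : k + 1 ≤ n) (c : ℝ)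
    (hc : 0 ≤ c) :
    ∃ C : ℝ, 0 ≤ C ∧ ∀ (Ω : Set (E n)) (q Q N A ρ : ℝ) (f φ v : E n → ℝ),
      MeasurableSet Ω → 1 ≤ q → 0 ≤ Q → Q ≤ c * q → 0 ≤ N → N ≤ A → 0 < ρ →
      ContDiff ℝ ∞ f → HasCompactSupport f →
      (∀ ζ, ‖𝓕 (toC f) ζ‖ ≤ A * (ρ * ‖ζ‖ / (1 + (ρ * ‖ζ‖) ^ 2))) →
      Measurable φ → Integrable φ → MemLp φ 2 → Measurable v → Integrable v → MemLp v 2 →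
      (∀ x ∉ Ω, φ x = 0) →
      ∫⁻ y, ‖f y‖ₑ ≤ ENNReal.ofReal N →
      (∀ y, ‖f y‖ₑ * volume Ω ≤ ENNReal.ofReal (N * Q)) →
      ∫⁻ t in Set.Ioi (1 : ℝ),
          ENNReal.ofReal (scaleWeight n k t * (t - 1)) * ‖scalePairing f φ v t‖ₑ ≤
        ENNReal.ofReal (C * A * kappa n (k + 1) q) *
          (eLpNorm φ 2 volume * eLpNorm v 2 volume) := by
  obtain ⟨C, hC, h⟩ := exists_lintegral_scalePairing_small_le n k (by omega) c hc
  refine ⟨C + 2 ^ n * Real.pi, by positivity, ?_⟩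
  intro Ω q Q N A ρ f φ v hΩ hq hQ hQq hN hNA hρ hf hfc hFA hφ hφ1 hφ2 hv hv1 hv2 hφΩ hfN hfQ
  set X := eLpNorm φ 2 volume * eLpNorm v 2 volume with hX
  have hκ := one_le_kappa n (k + 1) hq
  have hA : 0 ≤ A := hN.trans hNA
  rw [← Set.Ioc_union_Ioi_eq_Ioi (one_le_two (α := ℝ)),
    lintegral_union measurableSet_Ioi (Set.Ioc_disjoint_Ioi le_rfl), add_mul, add_mul,
    ENNReal.ofReal_add (by positivity) (by positivity), add_mul]
  gcongr
  · refine (h Ω q Q N f φ v _ hΩ hq hQ hQq hN hf.continuous.measurable hφ hv hφΩ hfN hfQ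
      fun t ht => ?_).trans ?_
    · exact (mul_le_of_le_one_right (scaleWeight_nonneg ht.1) (by linarith [ht.2])).trans
        (scaleWeight_le_small ht)
    · gcongr
  · calc _ ≤ ∫⁻ t in Set.Ioi (2 : ℝ),
          ENNReal.ofReal (t ^ (n - 1)) * ‖scalePairing f φ v t‖ₑ := by
          refine setLIntegral_mono' measurableSet_Ioi fun t ht => ?_
          have ht : 2 < t := ht
          gcongr
          refine le_trans ?_ (scaleWeight_mul_le hk (by linarith : 1 < t))
          have := scaleWeight_nonneg (n := n) (k := k) (by linarith : 1 < t)
          gcongr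
          linarith
      _ ≤ _ := lintegral_scalePairing_large_le (by omega) hf hfc hφ1 hφ2 hv1 hv2 hA hρ hFA
      _ ≤ _ := by
          rw [mul_assoc, ← hX]
          refine mul_le_mul_left (ENNReal.ofReal_le_ofReal ?_) _
          rw [show 2 ^ n * A * Real.pi = 2 ^ n * Real.pi * A by ring]
          exact le_mul_of_one_le_right (by positivity) hκ

end PoincareEstimate

/-! ### Absolute integrability of the kernel -/

namespace PoincareEstimate

open MeasureTheory FourierTransform
open scoped ContDiff ENNReal

noncomputable section

/-- The integrand of the kernel `G_{n-k}(y, x)` at the scale `t`. -/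
def sliceKernel {n : ℕ} (k : ℕ) (θ : E n → ℝ) (t : ℝ) (x y : E n) : ℝ :=
  (t - 1) ^ k * t ^ (n - k - 1) * θ (t • y - (t - 1) • x)

theorem G_eq_integral_sliceKernel {n k : ℕ} (hk : k + 1 ≤ n) (θ : E n → ℝ) (x y : E n) :
    G θ ((n : ℤ) - ((k + 1 : ℕ) : ℤ) + 1) y x =
      ∫ t in Set.Ioi (1 : ℝ), sliceKernel k θ t x y := by
  refine setIntegral_congr_fun measurableSet_Ioi fun t _ => ?_
  have h1 : (n : ℤ) - ((n : ℤ) - ((k + 1 : ℕ) : ℤ) + 1) = (k : ℕ) := by push_cast; ring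
  have h2 : (n : ℤ) - ((k + 1 : ℕ) : ℤ) + 1 - 1 = ((n - k - 1 : ℕ) : ℤ) := by omega
  simp only [sliceKernel]
  rw [h1, h2, zpow_natCast, zpow_natCast]
  congr 2
  module

/-- The kernel of absolute values dominating `G_{n-k}(y, x) (x - y)`. -/
def absKernel {n : ℕ} (k : ℕ) (θ : E n → ℝ) (x y : E n) : ℝ≥0∞ :=
  ∫⁻ t in Set.Ioi (1 : ℝ), ‖sliceKernel k θ t x y‖ₑ * ‖x - y‖ₑ

section

variable {n k : ℕ} {θ : E n → ℝ}

theorem continuous_sliceKernel (hθ : Continuous θ) :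
    Continuous fun p : (E n × E n) × ℝ => sliceKernel k θ p.2 p.1.1 p.1.2 := by
  unfold sliceKernel
  fun_prop

theorem measurable_absKernel (hθ : Continuous θ) :
    Measurable fun p : E n × E n => absKernel k θ p.1 p.2 := by
  refine Measurable.lintegral_prod_right' (f := fun p : (E n × E n) × ℝ =>
    ‖sliceKernel k θ p.2 p.1.1 p.1.2‖ₑ * ‖p.1.1 - p.1.2‖ₑ) ?_
  exact (continuous_sliceKernel hθ).measurable.enorm.mul (by fun_prop)

theorem measurable_absKernel_left (hθ : Continuous θ) (y : E n) :
    Measurable fun x : E n => absKernel k θ x y := by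
  have h := (measurable_absKernel (k := k) hθ).comp
    (measurable_prodMk_right (y := y) (β := E n) : Measurable fun x : E n => (x, y))
  simpa only [Function.comp_def] using h

theorem measurable_absKernel_right (hθ : Continuous θ) (x : E n) :
    Measurable fun y : E n => absKernel k θ x y := by
  have h := (measurable_absKernel (k := k) hθ).comp
    (measurable_prodMk_left (x := x) (β := E n) : Measurable fun y : E n => (x, y))
  simpa only [Function.comp_def] using h

/-- Where θ(a) ≠ 0, with a = ty - (t-1)x, the identity t(x-y) = (x-c) - (a-c) gives ‖x-y‖ ≤ (R+r)/t.
This gain is the division by t in `scaleWeight`. -/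
theorem enorm_sliceKernel_mul_le {c : E n} {r R : ℝ} (hθc : ∀ a, θ a ≠ 0 → ‖a - c‖ ≤ r)
    {x : E n} (hx : ‖x - c‖ ≤ R) (y : E n) {t : ℝ} (ht : 1 < t) :
    ‖sliceKernel k θ t x y‖ₑ * ‖x - y‖ₑ ≤
      ENNReal.ofReal (R + r) * (ENNReal.ofReal (scaleWeight n k t) *
        ‖θ (t • y - (t - 1) • x)‖ₑ) := by
  have ht0 : 0 < t := by linarith
  have ht1 : 0 < t - 1 := by linarith
  set a := t • y - (t - 1) • x with ha
  by_cases h0 : θ a = 0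
  · simp [sliceKernel, ← ha, h0]
  have h1 : t * ‖x - y‖ ≤ R + r := by
    have : t • (x - y) = (x - c) - (a - c) := by rw [ha]; module
    rw [← Real.norm_of_nonneg ht0.le, ← norm_smul, this]
    exact (norm_sub_le _ _).trans (add_le_add hx (hθc a h0))
  have h2 : 0 ≤ R + r := le_trans (by positivity) h1
  have h3 : ‖x - y‖ ≤ (R + r) / t := by rwa [le_div_iff₀ ht0, mul_comm]
  simp only [← ofReal_norm]
  rw [← ENNReal.ofReal_mul (by positivity), ← ENNReal.ofReal_mul (scaleWeight_nonneg ht),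
    ← ENNReal.ofReal_mul h2]
  refine ENNReal.ofReal_le_ofReal ?_
  rw [sliceKernel, ← ha, norm_mul, Real.norm_of_nonneg (by positivity), scaleWeight]
  calc _ ≤ (t - 1) ^ k * t ^ (n - k - 1) * ‖θ a‖ * ((R + r) / t) := by gcongr
    _ = _ := by ring

theorem scaleWeight_div_pow_le (hk : k + 1 ≤ n) {t : ℝ} (ht : 1 < t) :
    scaleWeight n k t * (t ^ n)⁻¹ ≤ (t ^ 2)⁻¹ := by
  have ht0 : 0 < t := by linarith
  have h3 : scaleWeight n k t ≤ t ^ (n - 1) / t := by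
    rw [le_div_iff₀ ht0]
    exact scaleWeight_mul_le hk ht
  calc _ ≤ t ^ (n - 1) / t * (t ^ n)⁻¹ := by gcongr
    _ = _ := by
      have : t ^ n = t ^ (n - 1) * t := by rw [← pow_succ]; congr 1; omega
      rw [this]
      field_simp

theorem lintegral_inv_sq_Ioi_one_le :
    ∫⁻ t in Set.Ioi (1 : ℝ), ENNReal.ofReal (t ^ 2)⁻¹ ≤ 2 := by
  rw [← Set.Ioc_union_Ioi_eq_Ioi (one_le_two (α := ℝ)),
    lintegral_union measurableSet_Ioi (Set.Ioc_disjoint_Ioi le_rfl),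
    show (2 : ℝ≥0∞) = 1 + 1 from one_add_one_eq_two.symm]
  refine add_le_add ?_ ?_
  · calc _ ≤ ∫⁻ t in Set.Ioc (1 : ℝ) 2, 1 := by
          refine setLIntegral_mono' measurableSet_Ioc fun t ht => ?_
          rw [← ENNReal.ofReal_one]
          exact ENNReal.ofReal_le_ofReal (inv_le_one_of_one_le₀ (one_le_pow₀ ht.1.le))
      _ = 1 := by norm_num
  · exact lintegral_inv_sq_Ioi_two_le

/-- First half of a Schur test: the Jacobian t^n in y does not degenerate at t = 1, and the weight
times t^{-n} is at most t^{-2}. -/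
theorem lintegral_absKernel_right_le (hk : k + 1 ≤ n) (hθ : Continuous θ) {c : E n} {r R : ℝ}
    (hθc : ∀ a, θ a ≠ 0 → ‖a - c‖ ≤ r) {x : E n} (hx : ‖x - c‖ ≤ R) :
    ∫⁻ y, absKernel k θ x y ≤ ENNReal.ofReal (R + r) * (2 * ∫⁻ a, ‖θ a‖ₑ) := by
  have hm : Measurable fun p : E n × ℝ => ‖sliceKernel k θ p.2 x p.1‖ₑ * ‖x - p.1‖ₑ := by
    refine Measurable.mul (Continuous.measurable ?_).enorm (by fun_prop)
    exact (continuous_sliceKernel hθ).comp (g := fun p : (E n × E n) × ℝ =>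
      sliceKernel k θ p.2 p.1.1 p.1.2) (f := fun p : E n × ℝ => ((x, p.1), p.2)) (by fun_prop)
  unfold absKernel
  rw [lintegral_lintegral_swap hm.aemeasurable]
  calc _ ≤ ∫⁻ t in Set.Ioi (1 : ℝ), ENNReal.ofReal (R + r) *
        (ENNReal.ofReal (t ^ 2)⁻¹ * ∫⁻ a, ‖θ a‖ₑ) := by
        refine setLIntegral_mono' measurableSet_Ioi fun t ht => ?_
        have ht0 : (0 : ℝ) < t := lt_trans one_pos ht
        refine (lintegral_mono fun y => enorm_sliceKernel_mul_le hθc hx y ht).trans ?_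
        rw [lintegral_const_mul' _ _ ENNReal.ofReal_ne_top,
          lintegral_const_mul' _ _ ENNReal.ofReal_ne_top,
          lintegral_enorm_comp_smul_sub hθ.measurable ht0, ← mul_assoc (ENNReal.ofReal _)
          (ENNReal.ofReal _) (∫⁻ a, ‖θ a‖ₑ), ← ENNReal.ofReal_mul (scaleWeight_nonneg ht)]
        gcongr
        exact scaleWeight_div_pow_le hk ht
    _ ≤ _ := by
        rw [lintegral_const_mul' _ _ ENNReal.ofReal_ne_top, lintegral_mul_const _ (by fun_prop)]
        gcongr
        exact lintegral_inv_sq_Ioi_one_le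

/-- Second half of the Schur test: the Jacobian (t-1)^n in x degenerates at t = 1, so scales t ≤ 2
are bounded by the sup of θ times |Ω|, and only t > 2 uses the change of variables. -/
theorem lintegral_absKernel_left_le (hk : k + 1 ≤ n) (hθ : Continuous θ) {c : E n} {r R M : ℝ}
    (hθc : ∀ a, θ a ≠ 0 → ‖a - c‖ ≤ r) (hM : ∀ a, ‖θ a‖ ≤ M) {Ω : Set (E n)}
    (hΩ : MeasurableSet Ω) (hΩR : ∀ x ∈ Ω, ‖x - c‖ ≤ R) (y : E n) :
    ∫⁻ x in Ω, absKernel k θ x y ≤ ENNReal.ofReal (R + r) *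
      (ENNReal.ofReal (2 ^ n * M) * volume Ω + ENNReal.ofReal (2 ^ n) * ∫⁻ a, ‖θ a‖ₑ) := by
  have hM0 : 0 ≤ M := (norm_nonneg _).trans (hM 0)
  have hm : Measurable fun p : E n × ℝ => ‖sliceKernel k θ p.2 p.1 y‖ₑ * ‖p.1 - y‖ₑ := by
    refine Measurable.mul (Continuous.measurable ?_).enorm (by fun_prop)
    exact (continuous_sliceKernel hθ).comp (g := fun p : (E n × E n) × ℝ =>
      sliceKernel k θ p.2 p.1.1 p.1.2) (f := fun p : E n × ℝ => ((p.1, y), p.2)) (by fun_prop)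
  unfold absKernel
  rw [lintegral_lintegral_swap hm.aemeasurable]
  have key : ∀ t ∈ Set.Ioi (1 : ℝ), ∫⁻ x in Ω, ‖sliceKernel k θ t x y‖ₑ * ‖x - y‖ₑ ≤
      ENNReal.ofReal (R + r) * (ENNReal.ofReal (scaleWeight n k t) *
        ∫⁻ x in Ω, ‖θ (t • y - (t - 1) • x)‖ₑ) := by
    intro t ht
    refine (setLIntegral_mono' hΩ fun x hx =>
      enorm_sliceKernel_mul_le hθc (hΩR x hx) y ht).trans_eq ?_
    rw [lintegral_const_mul' _ _ ENNReal.ofReal_ne_top,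
      lintegral_const_mul' _ _ ENNReal.ofReal_ne_top]
  refine (setLIntegral_mono' measurableSet_Ioi key).trans ?_
  rw [lintegral_const_mul' _ _ ENNReal.ofReal_ne_top]
  gcongr
  rw [← Set.Ioc_union_Ioi_eq_Ioi (one_le_two (α := ℝ)),
    lintegral_union measurableSet_Ioi (Set.Ioc_disjoint_Ioi le_rfl)]
  gcongr
  · calc _ ≤ ∫⁻ t in Set.Ioc (1 : ℝ) 2, ENNReal.ofReal (2 ^ n * M) * volume Ω := by
          refine setLIntegral_mono' measurableSet_Ioc fun t ht => ?_
          rw [ENNReal.ofReal_mul (by positivity), mul_assoc]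
          gcongr
          · refine (scaleWeight_le_small ht).trans (mul_le_of_le_one_right (by positivity) ?_)
            exact pow_le_one₀ (by linarith [ht.1]) (by linarith [ht.2])
          · calc _ ≤ ∫⁻ x in Ω, ENNReal.ofReal M := by
                  refine lintegral_mono fun x => ?_
                  rw [← ofReal_norm]
                  exact ENNReal.ofReal_le_ofReal (hM _)
              _ = _ := setLIntegral_const _ _
      _ = _ := by
          rw [setLIntegral_const]
          norm_num
  · calc _ ≤ ∫⁻ t in Set.Ioi (2 : ℝ),
          ENNReal.ofReal (2 ^ n) * (ENNReal.ofReal (t ^ 2)⁻¹ * ∫⁻ a, ‖θ a‖ₑ) := by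
          refine setLIntegral_mono' measurableSet_Ioi fun t ht => ?_
          have ht : 2 < t := ht
          have ht1 : 0 < t - 1 := by linarith
          have ht0 : 0 < t := by linarith
          refine (mul_le_mul_right (setLIntegral_le_lintegral _ _) _).trans ?_
          rw [lintegral_enorm_comp_sub_smul hθ.measurable ht1, ← mul_assoc, ← mul_assoc,
            ← ENNReal.ofReal_mul (scaleWeight_nonneg (by linarith)),
            ← ENNReal.ofReal_mul (by positivity)]
          refine mul_le_mul_left (ENNReal.ofReal_le_ofReal ?_) _
          have h1 : ((t - 1) ^ n)⁻¹ ≤ 2 ^ n * (t ^ n)⁻¹ := by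
            rw [← div_eq_mul_inv, ← div_pow, ← inv_pow]
            gcongr
            rw [inv_le_comm₀ ht1 (by positivity), inv_div]
            linarith
          calc _ ≤ scaleWeight n k t * (2 ^ n * (t ^ n)⁻¹) :=
                mul_le_mul_of_nonneg_left h1 (scaleWeight_nonneg (by linarith))
            _ = 2 ^ n * (scaleWeight n k t * (t ^ n)⁻¹) := by ring
            _ ≤ _ := by
                gcongr
                exact scaleWeight_div_pow_le hk (by linarith)
      _ ≤ ENNReal.ofReal (2 ^ n) * (1 * ∫⁻ a, ‖θ a‖ₑ) := by
          rw [lintegral_const_mul' _ _ ENNReal.ofReal_ne_top, lintegral_mul_const _ (by fun_prop)]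
          gcongr
          exact lintegral_inv_sq_Ioi_two_le
      _ = _ := by rw [one_mul]

/-- Integrability of `|G_{n-k}(y, x)| |x - y| h(y)` on `Ω × ℝⁿ`. -/
theorem lintegral_absKernel_mul_ne_top (hk : k + 1 ≤ n) (hθ : Continuous θ)
    (hθi : Integrable θ) {c : E n} {r R M : ℝ}
    (hθc : ∀ a, θ a ≠ 0 → ‖a - c‖ ≤ r) (hM : ∀ a, ‖θ a‖ ≤ M) {Ω : Set (E n)}
    (hΩ : MeasurableSet Ω) (hΩR : ∀ x ∈ Ω, ‖x - c‖ ≤ R) (hΩ' : volume Ω ≠ ⊤)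
    {h : E n → ℝ≥0∞} (hh : Measurable h) (hh' : ∫⁻ y, h y ≠ ⊤) :
    ∫⁻ x in Ω, ∫⁻ y, absKernel k θ x y * h y ≠ ⊤ := by
  have hm := measurable_absKernel (k := k) hθ
  rw [lintegral_lintegral_swap (Measurable.aemeasurable
    (hm.mul (hh.comp measurable_snd) :
      Measurable fun p : E n × E n => absKernel k θ p.1 p.2 * h p.2))]
  set C := ENNReal.ofReal (R + r) *
    (ENNReal.ofReal (2 ^ n * M) * volume Ω + ENNReal.ofReal (2 ^ n) * ∫⁻ a, ‖θ a‖ₑ)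
  have hC : C ≠ ⊤ := ENNReal.mul_ne_top ENNReal.ofReal_ne_top (ENNReal.add_ne_top.2
    ⟨ENNReal.mul_ne_top ENNReal.ofReal_ne_top hΩ',
      ENNReal.mul_ne_top ENNReal.ofReal_ne_top hθi.2.ne⟩)
  have hle : ∀ y, ∫⁻ x in Ω, absKernel k θ x y * h y ≤ C * h y := fun y => by
    rw [lintegral_mul_const _ (measurable_absKernel_left hθ y)]
    gcongr
    exact lintegral_absKernel_left_le hk hθ hθc hM hΩ hΩR y
  refine ne_top_of_le_ne_top ?_ (lintegral_mono hle)
  rw [lintegral_const_mul _ hh]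
  exact ENNReal.mul_ne_top hC hh'

end

end

end PoincareEstimate

/-! ### The scalar operator: convergence, L² membership, Fubini -/

namespace PoincareEstimate

open MeasureTheory FourierTransform
open scoped ContDiff ENNReal

noncomputable section

/-- The kernel `G_{n-k}(y, x)`. -/
def scaleKernel {n : ℕ} (k : ℕ) (θ : E n → ℝ) (x y : E n) : ℝ :=
  ∫ t in Set.Ioi (1 : ℝ), sliceKernel k θ t x y

/-- The scalar operator `v ↦ ∫ G_{n-k}(y, x) (x - y)_i v(y) dy`. -/
def scalarOp {n : ℕ} (k : ℕ) (θ : E n → ℝ) (i : Fin n) (v : E n → ℝ) (x : E n) : ℝ :=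
  ∫ y, scaleKernel k θ x y * (x - y) i * v y

section

variable {n k : ℕ} {θ : E n → ℝ}

theorem measurable_scaleKernel (hθ : Continuous θ) :
    Measurable fun p : E n × E n => scaleKernel k θ p.1 p.2 :=
  (StronglyMeasurable.integral_prod_right' (f := fun p : (E n × E n) × ℝ =>
    sliceKernel k θ p.2 p.1.1 p.1.2) (continuous_sliceKernel hθ).stronglyMeasurable).measurable

theorem measurable_scalarOp_integrand (hθ : Continuous θ) (i : Fin n) {v : E n → ℝ}
    (hv : Measurable v) :
    Measurable fun p : E n × E n => scaleKernel k θ p.1 p.2 * (p.1 - p.2) i * v p.2 :=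
  ((measurable_scaleKernel hθ).mul (by fun_prop)).mul (by fun_prop)

theorem rpow_half_sq (a : ℝ≥0∞) : (a ^ (1 / 2 : ℝ)) ^ 2 = a := by
  rw [← ENNReal.rpow_natCast, ← ENNReal.rpow_mul]
  norm_num

theorem enorm_apply_le (z : E n) (i : Fin n) : ‖z i‖ₑ ≤ ‖z‖ₑ := by
  rw [← ofReal_norm, ← ofReal_norm]
  exact ENNReal.ofReal_le_ofReal (PiLp.norm_apply_le z i)

theorem enorm_scalarOp_integrand_le (i : Fin n) (v : E n → ℝ) (x y : E n) :
    ‖scaleKernel k θ x y * (x - y) i * v y‖ₑ ≤ absKernel k θ x y * ‖v y‖ₑ := by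
  rw [enorm_mul, enorm_mul, absKernel, lintegral_mul_const' _ _ enorm_ne_top]
  gcongr
  · exact enorm_integral_le_lintegral_enorm _
  · exact enorm_apply_le _ i

theorem ae_integrable_scalarOp
    (hk : k + 1 ≤ n) (hθ : Continuous θ) (hθi : Integrable θ) {c : E n} {r R M : ℝ}
    (hθc : ∀ a, θ a ≠ 0 → ‖a - c‖ ≤ r) (hM : ∀ a, ‖θ a‖ ≤ M) {Ω : Set (E n)}
    (hΩ : MeasurableSet Ω) (hΩR : ∀ x ∈ Ω, ‖x - c‖ ≤ R) (hΩ' : volume Ω ≠ ⊤)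
    (i : Fin n) {v : E n → ℝ} (hv : Measurable v)
    (hvi : Integrable v) :
    ∀ᵐ x ∂(volume.restrict Ω), Integrable fun y => scaleKernel k θ x y * (x - y) i * v y := by
  have h := lintegral_absKernel_mul_ne_top hk hθ hθi hθc hM hΩ hΩR hΩ' hv.enorm hvi.2.ne
  have hm : Measurable fun p : E n × E n => absKernel k θ p.1 p.2 * ‖v p.2‖ₑ :=
    (measurable_absKernel hθ).mul (by fun_prop)
  filter_upwards [ae_lt_top hm.lintegral_prod_right' h] with x hx
  refine ⟨((measurable_scalarOp_integrand hθ i hv).comp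
    (by fun_prop : Measurable fun y : E n => (x, y))).aestronglyMeasurable, ?_⟩
  exact (lintegral_mono fun y => enorm_scalarOp_integrand_le i v x y).trans_lt hx

/-- Schur test with the two marginals of `absKernel`. Only finiteness is at stake: the quantitative
bound on the derivatives comes from duality. -/
theorem memLp_scalarOp
    (hk : k + 1 ≤ n) (hθ : Continuous θ) (hθi : Integrable θ) {c : E n} {r R M : ℝ}
    (hθc : ∀ a, θ a ≠ 0 → ‖a - c‖ ≤ r) (hM : ∀ a, ‖θ a‖ ≤ M) {Ω : Set (E n)}
    (hΩ : MeasurableSet Ω) (hΩR : ∀ x ∈ Ω, ‖x - c‖ ≤ R) (hΩ' : volume Ω ≠ ⊤)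
    (i : Fin n) {v : E n → ℝ} (hv : Measurable v) (hv2 : MemLp v 2) :
    MemLp (scalarOp k θ i v) 2 (volume.restrict Ω) := by
  have hsm : StronglyMeasurable (scalarOp k θ i v) :=
    StronglyMeasurable.integral_prod_right' (f := fun p : E n × E n =>
      scaleKernel k θ p.1 p.2 * (p.1 - p.2) i * v p.2)
      (measurable_scalarOp_integrand hθ i hv).stronglyMeasurable
  refine ⟨hsm.aestronglyMeasurable, ?_⟩
  have hv2' : ∫⁻ y, ‖v y‖ₑ ^ 2 ≠ ⊤ := by
    have := hv2.2
    rw [eLpNorm_two_eq_lintegral] at this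
    intro h
    rw [h] at this
    simp at this
  have h := lintegral_absKernel_mul_ne_top hk hθ hθi hθc hM hΩ hΩR hΩ'
    (hv.enorm.pow_const 2) hv2'
  set D := ENNReal.ofReal (R + r) * (2 * ∫⁻ a, ‖θ a‖ₑ)
  have hD : D ≠ ⊤ := ENNReal.mul_ne_top ENNReal.ofReal_ne_top
    (ENNReal.mul_ne_top (by simp) hθi.2.ne)
  have key : ∀ x ∈ Ω, ‖scalarOp k θ i v x‖ₑ ^ 2 ≤
      D * ∫⁻ y, absKernel k θ x y * ‖v y‖ₑ ^ 2 := by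
    intro x hx
    have hmx := measurable_absKernel_right (k := k) hθ x
    have h1 : ‖scalarOp k θ i v x‖ₑ ≤ ∫⁻ y, absKernel k θ x y * (1 * ‖v y‖ₑ) := by
      refine (enorm_integral_le_lintegral_enorm _).trans (lintegral_mono fun y => ?_)
      rw [one_mul]
      exact enorm_scalarOp_integrand_le i v x y
    have h2 := h1.trans (lintegral_mul_mul_le volume hmx measurable_const hv.enorm)
    calc _ ≤ _ := pow_le_pow_left' h2 2
      _ = (∫⁻ y, absKernel k θ x y) * ∫⁻ y, absKernel k θ x y * ‖v y‖ₑ ^ 2 := by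
          rw [mul_pow, rpow_half_sq, rpow_half_sq]
          simp only [one_pow, mul_one]
      _ ≤ _ := by
          gcongr
          exact lintegral_absKernel_right_le hk hθ hθc (hΩR x hx)
  rw [eLpNorm_two_eq_lintegral]
  refine ENNReal.rpow_lt_top_of_nonneg (by norm_num) ?_
  refine ne_top_of_le_ne_top ?_ (setLIntegral_mono' hΩ key)
  rw [lintegral_const_mul' _ _ hD]
  exact ENNReal.mul_ne_top hD h

/-- Fubini's theorem for the pairing of `scalarOp` with a bounded function. -/
theorem setIntegral_scalarOp_mul
    (hk : k + 1 ≤ n) (hθ : Continuous θ) (hθi : Integrable θ) {c : E n} {r R M : ℝ}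
    (hθc : ∀ a, θ a ≠ 0 → ‖a - c‖ ≤ r) (hM : ∀ a, ‖θ a‖ ≤ M) {Ω : Set (E n)}
    (hΩ : MeasurableSet Ω) (hΩR : ∀ x ∈ Ω, ‖x - c‖ ≤ R) (hΩ' : volume Ω ≠ ⊤)
    (i : Fin n) {v : E n → ℝ} (hv : Measurable v)
    (hvi : Integrable v) {ψ : E n → ℝ} (hψ : Continuous ψ) {B : ℝ} (hB : ∀ x, ‖ψ x‖ ≤ B) :
    ∫ x in Ω, scalarOp k θ i v x * ψ x =
      ∫ t in Set.Ioi (1 : ℝ), (t - 1) ^ k * t ^ (n - k - 1) *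
        ∫ p : E n × E n in Ω ×ˢ Set.univ,
          ψ p.1 * ((p.1 - p.2) i * v p.2 * θ (t • p.2 - (t - 1) • p.1)) := by
  have h := lintegral_absKernel_mul_ne_top hk hθ hθi hθc hM hΩ hΩR hΩ' hv.enorm hvi.2.ne
  have hm : Measurable fun p : E n × E n => absKernel k θ p.1 p.2 * ‖v p.2‖ₑ :=
    (measurable_absKernel hθ).mul (by fun_prop)
  set F : (E n × E n) × ℝ → ℝ := fun q =>
    sliceKernel k θ q.2 q.1.1 q.1.2 * (q.1.1 - q.1.2) i * v q.1.2 * ψ q.1.1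
  have hFm : Measurable F := (((continuous_sliceKernel hθ).measurable.mul (by fun_prop)).mul
    (by fun_prop)).mul (by fun_prop)
  set μ : Measure (E n × E n) := (volume.restrict Ω).prod volume
  have hFi : Integrable F (μ.prod (volume.restrict (Set.Ioi 1))) := by
    refine ⟨hFm.aestronglyMeasurable, ?_⟩
    rw [HasFiniteIntegral, lintegral_prod _ hFm.enorm.aemeasurable,
      lintegral_prod _ (hFm.enorm.lintegral_prod_right').aemeasurable]
    have hle : ∀ x y, ∫⁻ t in Set.Ioi (1 : ℝ), ‖F ((x, y), t)‖ₑ ≤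
        (absKernel k θ x y * ‖v y‖ₑ) * ENNReal.ofReal B := by
      intro x y
      rw [absKernel, ← lintegral_mul_const' _ _ enorm_ne_top,
        ← lintegral_mul_const' _ _ ENNReal.ofReal_ne_top]
      refine lintegral_mono fun t => ?_
      simp only [F, enorm_mul]
      gcongr
      · exact enorm_apply_le _ i
      · rw [← ofReal_norm]
        exact ENNReal.ofReal_le_ofReal (hB x)
    refine (lintegral_mono fun x => lintegral_mono fun y => hle x y).trans_lt ?_
    simp only [lintegral_mul_const' _ _ ENNReal.ofReal_ne_top]
    exact (ENNReal.mul_ne_top h ENNReal.ofReal_ne_top).lt_top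
  calc _ = ∫ x in Ω, ∫ y, ∫ t in Set.Ioi (1 : ℝ), F ((x, y), t) := by
        refine integral_congr_ae (.of_forall fun x => ?_)
        simp only [scalarOp, F]
        rw [← integral_mul_const]
        refine integral_congr_ae (.of_forall fun y => ?_)
        simp only [scaleKernel]
        rw [mul_assoc, mul_assoc, ← integral_mul_const]
        refine integral_congr_ae (.of_forall fun t => ?_)
        simp only
        ring
    _ = ∫ p, (∫ t in Set.Ioi (1 : ℝ), F (p, t)) ∂μ := by
        rw [integral_prod _ hFi.integral_prod_left]
    _ = ∫ t in Set.Ioi (1 : ℝ), (∫ p, F (p, t) ∂μ) :=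
        integral_integral_swap hFi
    _ = _ := by
        refine integral_congr_ae (.of_forall fun t => ?_)
        simp only [F, sliceKernel]
        rw [← integral_const_mul, Measure.volume_eq_prod, ← Measure.prod_restrict,
          Measure.restrict_univ]
        refine integral_congr_ae (.of_forall fun p => ?_)
        simp only
        ring

end

end

end PoincareEstimate

/-! ### Integration by parts at a fixed scale -/

namespace PoincareEstimate

open MeasureTheory FourierTransform
open scoped ContDiff ENNReal

variable {n : ℕ}

theorem integrable_scalePairing {f φ v : E n → ℝ} (hf : Continuous f) (hfc : HasCompactSupport f)
    (hφ : Integrable φ) (hv : Integrable v) (t : ℝ) :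
    Integrable fun p : E n × E n => φ p.1 * v p.2 * f (t • p.2 - (t - 1) • p.1) := by
  obtain ⟨B, hB⟩ := hf.bounded_above_of_compact_support hfc
  exact (hφ.mul_prod hv).mul_bdd (c := B) (by fun_prop) (.of_forall fun p => hB _)

theorem measurable_scalePairing {f φ v : E n → ℝ} (hf : Continuous f) (hφ : Measurable φ)
    (hv : Measurable v) : Measurable (scalePairing f φ v) := by
  refine (StronglyMeasurable.integral_prod_right' (f := fun q : ℝ × (E n × E n) =>
    φ q.2.1 * v q.2.2 * f (q.1 • q.2.2 - (q.1 - 1) • q.2.1)) ?_).measurable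
  refine Measurable.stronglyMeasurable ?_
  exact Measurable.mul (by fun_prop) (hf.measurable.comp (Continuous.measurable (by fun_prop)))

theorem contDiff_fderiv_apply {f : E n → ℝ} (hf : ContDiff ℝ ∞ f) (m : E n) :
    ContDiff ℝ ∞ fun x => fderiv ℝ f x m :=
  (hf.fderiv_right (by simp)).clm_apply contDiff_const

/-- Integration by parts for `scalePairing`. -/
theorem scalePairing_fderiv {f φ v : E n → ℝ} (hf : ContDiff ℝ ∞ f) (hfc : HasCompactSupport f)
    (hφ : ContDiff ℝ ∞ φ) (hφc : HasCompactSupport φ) (hv : Integrable v) (m : E n) (t : ℝ) :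
    scalePairing f (fun x => fderiv ℝ φ x m) v t =
      (t - 1) * scalePairing (fun x => fderiv ℝ f x m) φ v t := by
  have hφ' := contDiff_fderiv_apply hφ m
  have hf' := contDiff_fderiv_apply hf m
  have hφc' : HasCompactSupport fun x => fderiv ℝ φ x m := hφc.fderiv_apply (𝕜 := ℝ) _
  have hfc' : HasCompactSupport fun x => fderiv ℝ f x m := hfc.fderiv_apply (𝕜 := ℝ) _
  have hi1 := integrable_scalePairing hf.continuous hfc
    (hφ'.continuous.integrable_of_hasCompactSupport hφc') hv t
  have hi2 := integrable_scalePairing hf'.continuous hfc'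
    (hφ.continuous.integrable_of_hasCompactSupport hφc) hv t
  unfold scalePairing
  rw [Measure.volume_eq_prod, integral_prod_symm _ hi1, integral_prod_symm _ hi2,
    ← integral_const_mul]
  refine integral_congr_ae (.of_forall fun y => ?_)
  simp only
  set g : E n → ℝ := fun x => f (t • y - (t - 1) • x) with hg
  have hgs : ContDiff ℝ ∞ g := hf.comp (by fun_prop)
  -- The chain rule gives -(t-1); its sign cancels the one from integration by parts.
  have hgd : ∀ x, fderiv ℝ g x m = -(t - 1) * fderiv ℝ f (t • y - (t - 1) • x) m := by
    intro x
    have h1 : HasFDerivAt (fun x : E n => t • y - (t - 1) • x)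
        (-((t - 1) • ContinuousLinearMap.id ℝ (E n))) x :=
      ((hasFDerivAt_id x).const_smul (t - 1)).const_sub (t • y)
    have h2 := ((hf.differentiable (by simp)) (t • y - (t - 1) • x)).hasFDerivAt.comp x h1
    rw [show fderiv ℝ g x = _ from h2.fderiv]
    simp
    ring
  have hgc := contDiff_fderiv_apply hgs m
  have hibp := integral_mul_fderiv_eq_neg_fderiv_mul_of_integrable (μ := volume) (f := g) (g := φ)
    (v := m)
    ((hgc.continuous.mul hφ.continuous).integrable_of_hasCompactSupport hφc.mul_left)
    ((hgs.continuous.mul hφ'.continuous).integrable_of_hasCompactSupport hφc'.mul_left)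
    ((hgs.continuous.mul hφ.continuous).integrable_of_hasCompactSupport hφc.mul_left)
    (fun x _ => hgs.differentiable (by simp) x) (fun x _ => hφ.differentiable (by simp) x)
  calc ∫ x, fderiv ℝ φ x m * v y * f (t • y - (t - 1) • x)
      = v y * ∫ x, g x * fderiv ℝ φ x m := by
        rw [← integral_const_mul]
        refine integral_congr_ae (.of_forall fun x => ?_)
        simp only [hg]
        ring
    _ = _ := by
        rw [hibp, ← integral_neg, ← integral_const_mul, ← integral_const_mul]
        refine integral_congr_ae (.of_forall fun x => ?_)
        simp only [hgd]
        ring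

theorem fderiv_mul_coord {f : E n → ℝ} (hf : ContDiff ℝ ∞ f) (c : E n) (i j : Fin n) (x : E n) :
    fderiv ℝ (fun z => f z * (z - c) i) x (e j) =
      fderiv ℝ f x (e j) * (x - c) i + (if i = j then 1 else 0) * f x := by
  have h1 := ((hf.differentiable (by simp)) x).hasFDerivAt
  have h2 : HasFDerivAt (fun z : E n => (z - c) i) (EuclideanSpace.proj (𝕜 := ℝ) i) x := by
    have h3 : HasFDerivAt (fun z : E n => z - c) (ContinuousLinearMap.id ℝ (E n)) x :=
      (hasFDerivAt_id x).sub_const c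
    exact ((EuclideanSpace.proj i : E n →L[ℝ] ℝ).hasFDerivAt (x := x - c)).comp x h3
  rw [show fderiv ℝ (fun z => f z * (z - c) i) x = _ from (h1.mul h2).fderiv]
  simp [e]
  ring

theorem contDiff_mul_coord {f : E n → ℝ} (hf : ContDiff ℝ ∞ f) (c : E n) (i : Fin n) :
    ContDiff ℝ ∞ fun z => f z * (z - c) i := by
  refine hf.mul ?_
  exact (EuclideanSpace.proj i : E n →L[ℝ] ℝ).contDiff.comp
    (contDiff_id.sub contDiff_const)

/-- Integration by parts at a fixed scale. -/
theorem integral_fderiv_mul_slice {θ : E n → ℝ} (hθ : ContDiff ℝ ∞ θ)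
    (hθc : HasCompactSupport θ) (c : E n) {φ v : E n → ℝ} (hφ : ContDiff ℝ ∞ φ)
    (hφc : HasCompactSupport φ) (hv : Integrable v) (i j : Fin n) (t : ℝ) :
    t * ∫ p : E n × E n,
        fderiv ℝ φ p.1 (e j) * ((p.1 - p.2) i * v p.2 * θ (t • p.2 - (t - 1) • p.1)) =
      (t - 1) * scalePairing (fun x => fderiv ℝ θ x (e j)) (fun x => φ x * (x - c) i) v t -
        (if i = j then 1 else 0) * scalePairing θ φ v t -
        (t - 1) * scalePairing (fun x => fderiv ℝ (fun z => θ z * (z - c) i) x (e j)) φ v t := by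
  have hφ1 := contDiff_mul_coord hφ c i
  have hφ1c : HasCompactSupport fun x => φ x * (x - c) i := hφc.mul_right
  have hθ1 := contDiff_mul_coord hθ c i
  have hθ1c : HasCompactSupport fun x => θ x * (x - c) i := hθc.mul_right
  have hI : ∀ {ψ : E n → ℝ}, ContDiff ℝ ∞ ψ → HasCompactSupport ψ → Integrable ψ :=
    fun h hc => h.continuous.integrable_of_hasCompactSupport hc
  -- Undoing the integrations by parts puts the derivatives back on φ and makes the claim pointwise.
  -- With a = ty - (t-1)x it is t(x-y)_i = (x-c)_i - (a-c)_i combined with (x-c)_i ∂_jφ = ∂_j(φ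
  -- (x-c)_i) - δ_ij φ.
  rw [← scalePairing_fderiv hθ hθc hφ1 hφ1c hv, ← scalePairing_fderiv hθ1 hθ1c hφ hφc hv]
  have i1 := integrable_scalePairing hθ.continuous hθc
    (hI (contDiff_fderiv_apply hφ1 (e j)) (hφ1c.fderiv_apply (𝕜 := ℝ) _)) hv t
  have i2 := integrable_scalePairing hθ.continuous hθc (hI hφ hφc) hv t
  have i3 := integrable_scalePairing hθ1.continuous hθ1c
    (hI (contDiff_fderiv_apply hφ (e j)) (hφc.fderiv_apply (𝕜 := ℝ) _)) hv t
  unfold scalePairing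
  have i12 : Integrable fun p : E n × E n =>
      fderiv ℝ (fun z => φ z * (z - c) i) p.1 (e j) * v p.2 * θ (t • p.2 - (t - 1) • p.1) -
        (if i = j then 1 else 0) * (φ p.1 * v p.2 * θ (t • p.2 - (t - 1) • p.1)) :=
    i1.sub (i2.const_mul _)
  rw [← integral_const_mul, ← integral_const_mul, ← integral_sub i1 (i2.const_mul _),
    ← integral_sub i12 i3]
  refine integral_congr_ae (.of_forall fun p => ?_)
  simp only [fderiv_mul_coord hφ]
  simp only [PiLp.sub_apply, PiLp.smul_apply, smul_eq_mul]
  ring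

end PoincareEstimate

/-! ### Norms and Fourier decay of the regularizer -/

namespace PoincareEstimate

open MeasureTheory FourierTransform
open scoped ContDiff ENNReal

namespace IsRegularizer

variable {n : ℕ} {K : ℕ → ℝ} {c : E n} {r : ℝ} {θ : E n → ℝ}

theorem hasCompactSupport (h : IsRegularizer K c r θ) : HasCompactSupport θ :=
  (isCompact_closedBall c r).of_isClosed_subset (isClosed_tsupport θ) h.tsupport_subset

theorem norm_sub_le_of_mem_tsupport (h : IsRegularizer K c r θ) {a : E n} (ha : a ∈ tsupport θ) :
    ‖a - c‖ ≤ r := by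
  have := h.tsupport_subset ha
  rwa [Metric.mem_closedBall, dist_eq_norm] at this

/-- Absolute values make the constants nonnegative without a sign condition on K. -/
theorem div_pow_le (m : ℕ) (l : ℕ) : K m / Metric.diam (Metric.ball c r) ^ l ≤
    |K m| / Metric.diam (Metric.ball c r) ^ l := by
  have : 0 ≤ Metric.diam (Metric.ball c r) := Metric.diam_nonneg
  gcongr
  exact le_abs_self _

theorem integral_abs_le (h : IsRegularizer K c r θ) : ∫ x, |θ x| ≤ |K 0| := by
  have := (h.l1_bound 0 ![]).trans (div_pow_le 0 0)
  simpa [partialDeriv] using this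

theorem integral_abs_fderiv_le (h : IsRegularizer K c r θ) (j : Fin n) :
    ∫ x, |fderiv ℝ θ x (e j)| ≤ |K 1| / Metric.diam (Metric.ball c r) := by
  have := (h.l1_bound 1 ![j]).trans (div_pow_le 1 1)
  simpa [partialDeriv, iteratedFDeriv_one_apply] using this

theorem fderiv_fderiv_apply (h : IsRegularizer K c r θ) (j m : Fin n) (x : E n) :
    fderiv ℝ (fun y => fderiv ℝ θ y (e j)) x (e m) = fderiv ℝ (fderiv ℝ θ) x (e m) (e j) := by
  have h1 : DifferentiableAt ℝ (fderiv ℝ θ) x :=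
    ((h.contDiff.fderiv_right (m := ∞) (by simp)).differentiable (by simp)) x
  rw [fderiv_clm_apply h1 (by fun_prop)]
  simp

theorem integral_abs_fderiv_fderiv_le (h : IsRegularizer K c r θ) (j m : Fin n) :
    ∫ x, |fderiv ℝ (fun y => fderiv ℝ θ y (e j)) x (e m)| ≤
      |K 2| / Metric.diam (Metric.ball c r) ^ 2 := by
  have := (h.l1_bound 2 ![m, j]).trans (div_pow_le 2 2)
  simpa [partialDeriv, iteratedFDeriv_two_apply, h.fderiv_fderiv_apply] using this

theorem abs_le (h : IsRegularizer K c r θ) (x : E n) :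
    |θ x| ≤ |K 0| / Metric.diam (Metric.ball c r) ^ n := by
  have := (h.sup_bound 0 ![] x).trans (div_pow_le 0 (n + 0))
  simpa [partialDeriv] using this

theorem abs_fderiv_le (h : IsRegularizer K c r θ) (j : Fin n) (x : E n) :
    |fderiv ℝ θ x (e j)| ≤ |K 1| / Metric.diam (Metric.ball c r) ^ (n + 1) := by
  have := (h.sup_bound 1 ![j] x).trans (div_pow_le 1 (n + 1))
  simpa [partialDeriv, iteratedFDeriv_one_apply] using this

theorem mem_tsupport_of_fderiv_ne_zero {x : E n} {m : E n} (hx : fderiv ℝ θ x m ≠ 0) :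
    x ∈ tsupport θ := by
  refine support_fderiv_subset ℝ ?_
  rw [Function.mem_support]
  intro h0
  rw [h0] at hx
  simp at hx

/-- Stated for a number b so that it applies to θ and to its derivatives alike, all of which vanish
off the closed ball. -/
theorem abs_mul_coord_le {x : E n} (i : Fin n) {ρ b : ℝ} (hρ : r ≤ ρ)
    (hx : b ≠ 0 → ‖x - c‖ ≤ r) : |b * (x - c) i| ≤ ρ * |b| := by
  by_cases hb : b = 0
  · simp [hb]
  · rw [abs_mul, mul_comm]
    gcongr
    exact (PiLp.norm_apply_le (x - c) i).trans ((hx hb).trans hρ)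

end IsRegularizer

section Estimates

variable {n : ℕ} {K : ℕ → ℝ} {c : E n} {r : ℝ} {θ : E n → ℝ}

theorem lintegral_enorm_le_ofReal {f : E n → ℝ} (hf : Integrable f) {N : ℝ}
    (h : ∫ x, |f x| ≤ N) : ∫⁻ x, ‖f x‖ₑ ≤ ENNReal.ofReal N := by
  rw [← ofReal_integral_norm_eq_lintegral_enorm hf]
  exact ENNReal.ofReal_le_ofReal h

/-- The constant bounding the norms of the derivatives of a regularizer. -/
noncomputable def regConst (n : ℕ) (K : ℕ → ℝ) : ℝ :=
  2 * Real.pi * |K 0| + n * (|K 2| + 2 * |K 1|) + |K 1| + |K 0|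

theorem regConst_nonneg : 0 ≤ regConst n K := by
  have := Real.pi_pos
  unfold regConst
  positivity

theorem IsRegularizer.norm_fourier_fderiv_le (h : IsRegularizer K c r θ)
    (hρ : 0 < Metric.diam (Metric.ball c r)) (j : Fin n) (ζ : E n) :
    ‖𝓕 (toC fun x => fderiv ℝ θ x (e j)) ζ‖ ≤
      regConst n K / Metric.diam (Metric.ball c r) *
        (Metric.diam (Metric.ball c r) * ‖ζ‖ /
          (1 + (Metric.diam (Metric.ball c r) * ‖ζ‖) ^ 2)) := by
  refine (PoincareEstimate.norm_fourier_fderiv_le h.contDiff h.hasCompactSupport j hρ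
    h.integral_abs_le (fun i => h.integral_abs_fderiv_fderiv_le j i) ζ).trans ?_
  set ρ := Metric.diam (Metric.ball c r)
  gcongr
  have e1 : (n : ℝ) * (|K 2| / ρ ^ 2) * ρ = n * |K 2| / ρ := by field_simp
  rw [e1, ← add_div]
  gcongr
  unfold regConst
  have : 0 ≤ (n : ℝ) * (2 * |K 1|) := by positivity
  nlinarith [abs_nonneg (K 0), abs_nonneg (K 1)]

/-- On the support of θ one has |(z-c)_i| ≤ r ≤ ρ, and differentiating this factor removes it.
Either way a power of 1/ρ is regained, so the derivative scales in ρ like θ itself. -/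
theorem IsRegularizer.fderiv_mul_coord_bounds (h : IsRegularizer K c r θ)
    (hρ : 0 < Metric.diam (Metric.ball c r)) (hr : r ≤ Metric.diam (Metric.ball c r))
    (i j : Fin n) :
    ∫ x, |fderiv ℝ (fun z => θ z * (z - c) i) x (e j)| ≤ |K 1| + |K 0| ∧
    (∀ x, |fderiv ℝ (fun z => θ z * (z - c) i) x (e j)| ≤
      (|K 1| + |K 0|) / Metric.diam (Metric.ball c r) ^ n) ∧
    ∀ ζ, ‖𝓕 (toC fun x => fderiv ℝ (fun z => θ z * (z - c) i) x (e j)) ζ‖ ≤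
      regConst n K * (Metric.diam (Metric.ball c r) * ‖ζ‖ /
          (1 + (Metric.diam (Metric.ball c r) * ‖ζ‖) ^ 2)) := by
  have hl0 := h.integral_abs_le
  have hl1 := h.integral_abs_fderiv_le
  have hl2 := h.integral_abs_fderiv_fderiv_le
  have hs0 := h.abs_le
  have hs1 := h.abs_fderiv_le
  set ρ := Metric.diam (Metric.ball c r)
  have hθ := h.contDiff
  have hθc := h.hasCompactSupport
  have hI : ∀ {ψ : E n → ℝ}, ContDiff ℝ ∞ ψ → HasCompactSupport ψ → Integrable fun x => |ψ x| :=
    fun h hc => (h.continuous.integrable_of_hasCompactSupport hc).abs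
  have hθj : ∀ j, ContDiff ℝ ∞ fun x => fderiv ℝ θ x (e j) :=
    fun j => contDiff_fderiv_apply hθ (e j)
  have hθjc : ∀ j : Fin n, HasCompactSupport fun x => fderiv ℝ θ x (e j) :=
    fun j => hθc.fderiv_apply (𝕜 := ℝ) _
  have hI0 := hI hθ hθc
  have hI1 : ∀ j, Integrable fun x => |fderiv ℝ θ x (e j)| := fun j => hI (hθj j) (hθjc j)
  have hI2 : ∀ j m, Integrable fun x => |fderiv ℝ (fun y => fderiv ℝ θ y (e j)) x (e m)| :=
    fun j m => hI (contDiff_fderiv_apply (hθj j) (e m)) ((hθjc j).fderiv_apply (𝕜 := ℝ) _)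
  have hδ : ∀ (p : Prop) [Decidable p] (b : ℝ), |(if p then 1 else 0) * b| ≤ |b| := by
    intro p _ b
    split_ifs <;> simp
  have hp : ∀ x, |fderiv ℝ (fun z => θ z * (z - c) i) x (e j)| ≤
      ρ * |fderiv ℝ θ x (e j)| + |θ x| := by
    intro x
    rw [fderiv_mul_coord hθ]
    refine (abs_add_le _ _).trans (add_le_add ?_ (hδ _ _))
    exact IsRegularizer.abs_mul_coord_le i hr fun hb =>
      h.norm_sub_le_of_mem_tsupport (IsRegularizer.mem_tsupport_of_fderiv_ne_zero hb)
  have hθ1 := contDiff_mul_coord hθ c i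
  have hθ1c : HasCompactSupport fun x => θ x * (x - c) i := hθc.mul_right
  refine ⟨?_, fun x => (hp x).trans ?_, fun ζ => ?_⟩
  · calc _ ≤ ∫ x, (ρ * |fderiv ℝ θ x (e j)| + |θ x|) :=
          integral_mono (hI (contDiff_fderiv_apply hθ1 _) (hθ1c.fderiv_apply (𝕜 := ℝ) _))
            (((hI1 j).const_mul ρ).add hI0) hp
      _ = ρ * (∫ x, |fderiv ℝ θ x (e j)|) + ∫ x, |θ x| := by
          rw [integral_add ((hI1 j).const_mul ρ) hI0, integral_const_mul]
      _ ≤ ρ * (|K 1| / ρ) + |K 0| := by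
          gcongr
          exact hl1 j
      _ = _ := by field_simp
  · calc _ ≤ ρ * (|K 1| / ρ ^ (n + 1)) + |K 0| / ρ ^ n := by
          gcongr
          · exact hs1 j x
          · exact hs0 x
      _ = _ := by
          rw [pow_succ]
          field_simp
  · have ha : ∫ x, |θ x * (x - c) i| ≤ ρ * |K 0| := by
      calc _ ≤ ∫ x, ρ * |θ x| := by
            refine integral_mono (hI hθ1 hθ1c) (hI0.const_mul ρ) fun x => ?_
            exact IsRegularizer.abs_mul_coord_le i hr fun hb =>
              h.norm_sub_le_of_mem_tsupport (subset_tsupport _ hb)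
        _ ≤ _ := by
            rw [integral_const_mul]
            gcongr
    -- By Leibniz the linear factor is differentiated at most once, in direction j or in direction
    -- m; these two terms give 2|K 1|.
    have hb : ∀ m, ∫ x, |fderiv ℝ (fun y => fderiv ℝ (fun z => θ z * (z - c) i) y (e j)) x (e m)| ≤
        (|K 2| + 2 * |K 1|) / ρ := by
      intro m
      have hpt : ∀ x, |fderiv ℝ (fun y => fderiv ℝ (fun z => θ z * (z - c) i) y (e j)) x (e m)| ≤
          ρ * |fderiv ℝ (fun y => fderiv ℝ θ y (e j)) x (e m)| + |fderiv ℝ θ x (e j)| +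
            |fderiv ℝ θ x (e m)| := by
        intro x
        have e1 : (fun y => fderiv ℝ (fun z => θ z * (z - c) i) y (e j)) = fun y =>
            fderiv ℝ θ y (e j) * (y - c) i + (if i = j then 1 else 0) * θ y := by
          funext y
          exact fderiv_mul_coord hθ c i j y
        have d1 : DifferentiableAt ℝ (fun y => fderiv ℝ θ y (e j) * (y - c) i) x :=
          (contDiff_mul_coord (hθj j) c i).differentiable (by simp) x
        have d2 : DifferentiableAt ℝ (fun y => (if i = j then (1 : ℝ) else 0) * θ y) x :=
          (contDiff_const.mul hθ).differentiable (by simp) x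
        rw [e1, fderiv_fun_add d1 d2, fderiv_const_mul (hθ.differentiable (by simp) x)]
        rw [add_apply, fderiv_mul_coord (hθj j)]
        refine (abs_add_le _ _).trans (add_le_add ((abs_add_le _ _).trans
          (add_le_add ?_ (hδ _ _))) ?_)
        · exact IsRegularizer.abs_mul_coord_le i hr fun hb =>
            h.norm_sub_le_of_mem_tsupport (tsupport_fderiv_apply_subset ℝ (e j)
              (IsRegularizer.mem_tsupport_of_fderiv_ne_zero hb))
        · exact hδ (i = j) (fderiv ℝ θ x (e m))
      have hθ2 := contDiff_fderiv_apply (contDiff_fderiv_apply hθ1 (e j)) (e m)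
      calc _ ≤ ∫ x, (ρ * |fderiv ℝ (fun y => fderiv ℝ θ y (e j)) x (e m)| +
              |fderiv ℝ θ x (e j)| + |fderiv ℝ θ x (e m)|) :=
            integral_mono (hI hθ2 ((hθ1c.fderiv_apply (𝕜 := ℝ) _).fderiv_apply (𝕜 := ℝ) _))
              ((((hI2 j m).const_mul ρ).add (hI1 j)).add (hI1 m)) hpt
        _ = ρ * (∫ x, |fderiv ℝ (fun y => fderiv ℝ θ y (e j)) x (e m)|) +
              (∫ x, |fderiv ℝ θ x (e j)|) + ∫ x, |fderiv ℝ θ x (e m)| := by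
            have i12 : Integrable fun x =>
                ρ * |fderiv ℝ (fun y => fderiv ℝ θ y (e j)) x (e m)| + |fderiv ℝ θ x (e j)| :=
              ((hI2 j m).const_mul ρ).add (hI1 j)
            rw [integral_add i12 (hI1 m),
              integral_add ((hI2 j m).const_mul ρ) (hI1 j), integral_const_mul]
        _ ≤ ρ * (|K 2| / ρ ^ 2) + |K 1| / ρ + |K 1| / ρ := by
            gcongr
            · exact hl2 j m
            · exact hl1 j
            · exact hl1 m
        _ = _ := by
            field_simp
            ring
    refine (PoincareEstimate.norm_fourier_fderiv_le hθ1 hθ1c j hρ ha hb ζ).trans ?_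
    gcongr
    have e1 : 2 * Real.pi * (ρ * |K 0|) / ρ = 2 * Real.pi * |K 0| := by field_simp
    have e2 : (n : ℝ) * ((|K 2| + 2 * |K 1|) / ρ) * ρ = n * (|K 2| + 2 * |K 1|) := by field_simp
    rw [e1, e2]
    unfold regConst
    linarith [abs_nonneg (K 0), abs_nonneg (K 1)]

end Estimates

end PoincareEstimate

/-! ### The bilinear estimate -/

namespace PoincareEstimate

open MeasureTheory FourierTransform
open scoped ContDiff ENNReal

theorem norm_sub_le_diam {n : ℕ} {Ω : Set (E n)} (hb : Bornology.IsBounded Ω) {x c : E n}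
    (hx : x ∈ Ω) (hc : c ∈ Ω) : ‖x - c‖ ≤ Metric.diam Ω := by
  rw [← dist_eq_norm]
  exact Metric.dist_le_diam_of_mem hb hx hc

theorem enorm_mul_measure_le {n : ℕ} {f : E n → ℝ} {Ω : Set (E n)} (hΩ' : volume Ω ≠ ⊤)
    {N ρ : ℝ} (hf : ∀ y, |f y| ≤ N / ρ ^ n) (y : E n) :
    ‖f y‖ₑ * volume Ω ≤ ENNReal.ofReal (N * (volume.real Ω / ρ ^ n)) := by
  have hN : 0 ≤ N / ρ ^ n := (abs_nonneg _).trans (hf y)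
  rw [← ofReal_norm, ← ENNReal.ofReal_toReal hΩ', ← ENNReal.ofReal_mul (norm_nonneg _),
    ← Measure.real]
  refine ENNReal.ofReal_le_ofReal ?_
  rw [mul_div_assoc', mul_div_right_comm]
  gcongr
  exact hf y

/-- The estimate of the pairing of `scalarOp` with a derivative of a test function. -/
theorem exists_pairing_bound (n k : ℕ) (hk : k + 1 ≤ n) (K : ℕ → ℝ) :
    ∃ C : ℝ, 0 ≤ C ∧ ∀ (Ω : Set (E n)) (c : E n) (r : ℝ) (θ : E n → ℝ),
      IsOpen Ω → Bornology.IsBounded Ω → 0 < r → StarShapedWrt Ω (Metric.ball c r) →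
      IsRegularizer K c r θ → ∀ (i j : Fin n) (v φ : E n → ℝ),
      Measurable v → Integrable v → MemLp v 2 →
      ContDiff ℝ ∞ φ → HasCompactSupport φ → tsupport φ ⊆ Ω →
      ‖∫ x in Ω, scalarOp k θ i v x * fderiv ℝ φ x (e j)‖ₑ ≤
        ENNReal.ofReal (C * (Metric.diam Ω / Metric.diam (Metric.ball c r)) *
          kappa n (k + 1) (volume.real Ω / volume.real (Metric.ball c r))) *
          (eLpNorm φ 2 volume * eLpNorm v 2 volume) := by
  -- As |B| = β r^n and r ≤ ρ, one has Q = |Ω|/ρ^n ≤ βq; thus β, which depends only on n, is the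
  -- constant c of the scale estimates.
  set β : ℝ := volume.real (Metric.ball (0 : E n) 1)
  have hβ : 0 ≤ β := measureReal_nonneg
  obtain ⟨C₁, hC₁, hT₁⟩ := exists_lintegral_weight_scalePairing_le n k hk β hβ
  obtain ⟨C₂, hC₂, hT₂⟩ := exists_lintegral_weight_mul_scalePairing_le n k hk β hβ
  have hA0 : 0 ≤ regConst n K := regConst_nonneg
  -- One summand for the term with θ, and two equal ones for the terms with ∂_jθ and ∂_j((z-c)_i θ).
  refine ⟨C₁ * |K 0| + 2 * (C₂ * regConst n K), by positivity, ?_⟩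
  intro Ω c r θ hΩo hΩb hr hstar hreg i j v φ hv hvi hv2 hφ hφc hφΩ
  have : Nonempty (Fin n) := ⟨⟨0, by omega⟩⟩
  have : Nontrivial (E n) := inferInstance
  have hdiam : Metric.diam (Metric.ball c r) = 2 * r := Metric.diam_ball_eq c hr.le
  set ρ := Metric.diam (Metric.ball c r) with hρdef
  set R := Metric.diam Ω
  have hρ : 0 < ρ := by rw [hdiam]; positivity
  have hrρ : r ≤ ρ := by rw [hdiam]; linarith
  have hρR : ρ ≤ R := Metric.diam_mono hstar.1 hΩb
  have hR : 0 < R := hρ.trans_le hρR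
  have hc : c ∈ Ω := hstar.1 (Metric.mem_ball_self hr)
  have hΩ' : volume Ω ≠ ⊤ := hΩb.measure_lt_top.ne
  have hΩm := hΩo.measurableSet
  have hΩR : ∀ x ∈ Ω, ‖x - c‖ ≤ R := fun x hx => norm_sub_le_diam hΩb hx hc
  have hBpos : 0 < volume.real (Metric.ball c r) :=
    ENNReal.toReal_pos (Metric.measure_ball_pos _ _ hr).ne' measure_ball_lt_top.ne
  have hBvol : volume.real (Metric.ball c r) = r ^ n * β := by
    rw [Measure.real, Measure.addHaar_ball _ _ hr.le, ENNReal.toReal_mul,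
      ENNReal.toReal_ofReal (by positivity), finrank_euclideanSpace_fin]
    rfl
  set q := volume.real Ω / volume.real (Metric.ball c r) with hq
  have hq1 : 1 ≤ q := by
    rw [hq, one_le_div hBpos]
    exact measureReal_mono hstar.1 hΩ'
  set Q := volume.real Ω / ρ ^ n with hQ
  have hQ0 : 0 ≤ Q := by positivity
  have hQq : Q ≤ β * q := by
    have hβ' : 0 < β := by
      rw [hBvol] at hBpos
      exact pos_of_mul_pos_right hBpos (by positivity)
    rw [hQ, hq, hBvol]
    have : β * (volume.real Ω / (r ^ n * β)) = volume.real Ω / r ^ n := by field_simp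
    rw [this]
    gcongr
  have hκ := one_le_kappa n (k + 1) hq1
  set κ := kappa n (k + 1) q
  have hθ := hreg.contDiff
  have hθc := hreg.hasCompactSupport
  have hθi : Integrable θ := hθ.continuous.integrable_of_hasCompactSupport hθc
  have hθs : ∀ a, θ a ≠ 0 → ‖a - c‖ ≤ r := fun a ha =>
    hreg.norm_sub_le_of_mem_tsupport (subset_tsupport _ ha)
  have hφ0 : ∀ x ∉ Ω, φ x = 0 := fun x hx => image_eq_zero_of_notMem_tsupport fun h => hx (hφΩ h)
  have hψ := contDiff_fderiv_apply hφ (e j)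
  have hψc : HasCompactSupport fun x => fderiv ℝ φ x (e j) := hφc.fderiv_apply (𝕜 := ℝ) _
  obtain ⟨B, hB⟩ := hψ.continuous.bounded_above_of_compact_support hψc
  have hφi : Integrable φ := hφ.continuous.integrable_of_hasCompactSupport hφc
  have hφ2 : MemLp φ 2 := hφ.continuous.memLp_of_hasCompactSupport hφc
  set φ₁ : E n → ℝ := fun x => φ x * (x - c) i
  have hφ1 : ContDiff ℝ ∞ φ₁ := contDiff_mul_coord hφ c i
  have hφ1c : HasCompactSupport φ₁ := hφc.mul_right
  set f₂ : E n → ℝ := fun x => fderiv ℝ θ x (e j)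
  have hf₂ : ContDiff ℝ ∞ f₂ := contDiff_fderiv_apply hθ (e j)
  have hf₂c : HasCompactSupport f₂ := hθc.fderiv_apply (𝕜 := ℝ) _
  set f₃ : E n → ℝ := fun x => fderiv ℝ (fun z => θ z * (z - c) i) x (e j)
  have hf₃ : ContDiff ℝ ∞ f₃ := contDiff_fderiv_apply (contDiff_mul_coord hθ c i) (e j)
  have hf₃c : HasCompactSupport f₃ := HasCompactSupport.fderiv_apply (𝕜 := ℝ) hθc.mul_right _
  obtain ⟨g1, g2, g3⟩ := hreg.fderiv_mul_coord_bounds hρ hrρ i j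
  set X := eLpNorm φ 2 volume * eLpNorm v 2 volume with hX
  have hφ1X : eLpNorm φ₁ 2 volume ≤ ENNReal.ofReal R * eLpNorm φ 2 volume := by
    refine eLpNorm_le_mul_eLpNorm_of_ae_le_mul (.of_forall fun x => ?_) 2
    by_cases hx : x ∈ Ω
    · simp only [φ₁]
      rw [norm_mul, mul_comm]
      gcongr
      exact (PiLp.norm_apply_le (x - c) i).trans (hΩR x hx)
    · simp [φ₁, hφ0 x hx]
  have b1 := hT₁ Ω q Q |K 0| θ φ v hΩm hq1 hQ0 hQq (abs_nonneg _) hθ.continuous.measurable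
    hφ.continuous.measurable hv hφ0 (lintegral_enorm_le_ofReal hθi hreg.integral_abs_le)
    (enorm_mul_measure_le hΩ' hreg.abs_le)
  -- The only term of size R/ρ: ∂_jθ contributes 1/ρ and ‖φ₁‖₂ ≤ R‖φ‖₂ contributes R.
  have b2 := hT₂ Ω q Q (|K 1| / ρ) (regConst n K / ρ) ρ f₂ φ₁ v hΩm hq1 hQ0 hQq (by positivity)
    (by
      gcongr
      unfold regConst
      have := Real.pi_pos
      have : 0 ≤ 2 * Real.pi * |K 0| + n * (|K 2| + 2 * |K 1|) + |K 0| := by positivity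
      linarith)
    hρ hf₂ hf₂c (hreg.norm_fourier_fderiv_le hρ j)
    hφ1.continuous.measurable (hφ1.continuous.integrable_of_hasCompactSupport hφ1c)
    (hφ1.continuous.memLp_of_hasCompactSupport hφ1c) hv hvi hv2
    (fun x hx => by simp [φ₁, hφ0 x hx])
    (lintegral_enorm_le_ofReal (hf₂.continuous.integrable_of_hasCompactSupport hf₂c)
      (hreg.integral_abs_fderiv_le j))
    (enorm_mul_measure_le hΩ' fun y => by
      rw [div_div, ← pow_succ']
      exact hreg.abs_fderiv_le j y)
  have b3 := hT₂ Ω q Q (|K 1| + |K 0|) (regConst n K) ρ f₃ φ v hΩm hq1 hQ0 hQq (by positivity)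
    (by
      unfold regConst
      have := Real.pi_pos
      have : 0 ≤ 2 * Real.pi * |K 0| + n * (|K 2| + 2 * |K 1|) := by positivity
      linarith)
    hρ hf₃ hf₃c g3
    hφ.continuous.measurable hφi hφ2 hv hvi hv2 hφ0
    (lintegral_enorm_le_ofReal (hf₃.continuous.integrable_of_hasCompactSupport hf₃c) g1)
    (enorm_mul_measure_le hΩ' g2)
  have hfull : ∀ t : ℝ, ∫ p : E n × E n in Ω ×ˢ Set.univ,
      fderiv ℝ φ p.1 (e j) * ((p.1 - p.2) i * v p.2 * θ (t • p.2 - (t - 1) • p.1)) =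
      ∫ p : E n × E n,
        fderiv ℝ φ p.1 (e j) * ((p.1 - p.2) i * v p.2 * θ (t • p.2 - (t - 1) • p.1)) := by
    intro t
    refine setIntegral_eq_integral_of_forall_compl_eq_zero fun p hp => ?_
    have hp1 : p.1 ∉ Ω := fun h => hp ⟨h, Set.mem_univ _⟩
    have : fderiv ℝ φ p.1 (e j) = 0 := by
      by_contra h
      exact hp1 (hφΩ (IsRegularizer.mem_tsupport_of_fderiv_ne_zero h))
    rw [this, zero_mul]
  have hm1 : Measurable (scaleWeight n k) := by
    unfold scaleWeight
    fun_prop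
  have hs1 := measurable_scalePairing hθ.continuous hφ.continuous.measurable hv
  have hs2 := measurable_scalePairing hf₂.continuous hφ1.continuous.measurable hv
  rw [setIntegral_scalarOp_mul hk hθ.continuous hθi hθs hreg.abs_le hΩm hΩR hΩ' i hv hvi
    hψ.continuous hB]
  refine (enorm_integral_le_lintegral_enorm _).trans ?_
  calc _ ≤ ∫⁻ t in Set.Ioi (1 : ℝ),
        (ENNReal.ofReal (scaleWeight n k t * (t - 1)) * ‖scalePairing f₂ φ₁ v t‖ₑ +
        ENNReal.ofReal (scaleWeight n k t) * ‖scalePairing θ φ v t‖ₑ +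
        ENNReal.ofReal (scaleWeight n k t * (t - 1)) * ‖scalePairing f₃ φ v t‖ₑ) := by
        refine setLIntegral_mono' measurableSet_Ioi fun t ht => ?_
        have ht : 1 < t := ht
        have ht0 : 0 < t := by linarith
        have hw := scaleWeight_nonneg (n := n) (k := k) ht
        rw [hfull]
        have h1 := integral_fderiv_mul_slice hθ hθc c hφ hφc hvi i j t
        have h2 : (t - 1) ^ k * t ^ (n - k - 1) * ∫ p : E n × E n,
            fderiv ℝ φ p.1 (e j) * ((p.1 - p.2) i * v p.2 * θ (t • p.2 - (t - 1) • p.1)) =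
            scaleWeight n k t * (t - 1) * scalePairing f₂ φ₁ v t -
            scaleWeight n k t * ((if i = j then 1 else 0) * scalePairing θ φ v t) -
            scaleWeight n k t * (t - 1) * scalePairing f₃ φ v t := by
          calc _ = scaleWeight n k t * (t * ∫ p : E n × E n,
              fderiv ℝ φ p.1 (e j) *
                ((p.1 - p.2) i * v p.2 * θ (t • p.2 - (t - 1) • p.1))) := by
                rw [scaleWeight]
                field_simp
            _ = _ := by
                rw [h1]
                ring
        rw [h2]
        have ht1 : 0 < t - 1 := by linarith
        refine (enorm_sub_le).trans (add_le_add ((enorm_sub_le).trans (add_le_add ?_ ?_)) ?_)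
        · rw [enorm_mul, Real.enorm_of_nonneg (by positivity)]
        · rw [enorm_mul, Real.enorm_of_nonneg hw]
          gcongr
          split_ifs <;> simp
        · rw [enorm_mul, Real.enorm_of_nonneg (by positivity)]
    _ = (∫⁻ t in Set.Ioi (1 : ℝ),
          ENNReal.ofReal (scaleWeight n k t * (t - 1)) * ‖scalePairing f₂ φ₁ v t‖ₑ) +
        (∫⁻ t in Set.Ioi (1 : ℝ), ENNReal.ofReal (scaleWeight n k t) * ‖scalePairing θ φ v t‖ₑ) +
        ∫⁻ t in Set.Ioi (1 : ℝ),
          ENNReal.ofReal (scaleWeight n k t * (t - 1)) * ‖scalePairing f₃ φ v t‖ₑ := by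
        rw [lintegral_add_left (by fun_prop), lintegral_add_left (by fun_prop)]
    _ ≤ ENNReal.ofReal (C₂ * (regConst n K / ρ) * κ) *
          (ENNReal.ofReal R * eLpNorm φ 2 volume * eLpNorm v 2 volume) +
        ENNReal.ofReal (C₁ * |K 0| * κ) * X + ENNReal.ofReal (C₂ * regConst n K * κ) * X := by
        refine add_le_add (add_le_add (b2.trans ?_) b1) b3
        gcongr
    _ ≤ _ := by
        rw [mul_assoc (ENNReal.ofReal R), ← hX, ← mul_assoc,
          ← ENNReal.ofReal_mul (by positivity), ← add_mul, ← add_mul,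
          ← ENNReal.ofReal_add (by positivity) (by positivity),
          ← ENNReal.ofReal_add (by positivity) (by positivity)]
        refine mul_le_mul_left (ENNReal.ofReal_le_ofReal ?_) _
        -- The two other terms lack the factor R/ρ and are absorbed because it is at least one, B
        -- being contained in Ω.
        have hRρ : 1 ≤ R / ρ := (one_le_div hρ).2 hρR
        have e1 : C₂ * (regConst n K / ρ) * κ * R = C₂ * regConst n K * κ * (R / ρ) := by ring
        have e2 : C₁ * |K 0| * κ ≤ C₁ * |K 0| * κ * (R / ρ) :=
          le_mul_of_one_le_right (by positivity) hRρ
        have e3 : C₂ * regConst n K * κ ≤ C₂ * regConst n K * κ * (R / ρ) :=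
          le_mul_of_one_le_right (by positivity) hRρ
        calc _ ≤ C₂ * regConst n K * κ * (R / ρ) + C₁ * |K 0| * κ * (R / ρ) +
              C₂ * regConst n K * κ * (R / ρ) := by linarith
          _ = _ := by ring

end PoincareEstimate

/-! ### Weak derivatives by duality -/

namespace PoincareEstimate

open MeasureTheory FourierTransform
open scoped ContDiff ENNReal

/-- The bound makes L factor through ι as a functional of norm at most M on the range. Hahn–Banach
extends it to H with the same norm, and Riesz represents the extension. -/
theorem exists_inner_eq_of_bound {V H : Type*} [AddCommGroup V] [Module ℝ V]
    [NormedAddCommGroup H] [InnerProductSpace ℝ H] [CompleteSpace H] (L : V →ₗ[ℝ] ℝ)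
    (ι : V →ₗ[ℝ] H) {M : ℝ} (hM : 0 ≤ M) (h : ∀ x, ‖L x‖ ≤ M * ‖ι x‖) :
    ∃ g : H, ‖g‖ ≤ M ∧ ∀ x, inner ℝ g (ι x) = L x := by
  set l : StrongDual ℝ (LinearMap.range ι) := L.compLeftInverse ι
  have hl : ∀ x, l ⟨ι x, x, rfl⟩ = L x := fun x =>
    LinearMap.compLeftInverse_apply_of_bdd L ι ⟨M, h⟩ x (ι x) rfl
  have hlM : ‖l‖ ≤ M := by
    refine ContinuousLinearMap.opNorm_le_bound _ hM ?_
    rintro ⟨_, x, rfl⟩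
    rw [hl]
    exact h x
  obtain ⟨l', hl', hn⟩ := exists_extension_norm_eq (LinearMap.range ι) l
  refine ⟨(InnerProductSpace.toDual ℝ H).symm l', ?_, fun x => ?_⟩
  · rw [LinearIsometryEquiv.norm_map, hn]
    exact hlM
  · rw [InnerProductSpace.toDual_symm_apply, ← hl]
    exact hl' ⟨ι x, x, rfl⟩

/-- The smooth functions with compact support in `Ω`. -/
def testFunctions {n : ℕ} (Ω : Set (E n)) : Submodule ℝ (E n → ℝ) where
  carrier := {φ | ContDiff ℝ ∞ φ ∧ HasCompactSupport φ ∧ tsupport φ ⊆ Ω}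
  add_mem' := by
    rintro φ ψ ⟨h1, h2, h3⟩ ⟨h4, h5, h6⟩
    refine ⟨h1.add h4, h2.add h5, ?_⟩
    refine (closure_mono (Function.support_add φ ψ)).trans ?_
    rw [closure_union]
    exact Set.union_subset h3 h6
  zero_mem' := ⟨contDiff_const, HasCompactSupport.zero, by simp⟩
  smul_mem' := by
    rintro a φ ⟨h1, h2, h3⟩
    exact ⟨contDiff_const.smul h1, h2.smul_left (f := fun _ => a),
      (tsupport_smul_subset_right (fun _ => a) φ).trans h3⟩

variable {n : ℕ} {Ω : Set (E n)}

theorem eLpNorm_restrict_of_tsupport_subset (hΩ : MeasurableSet Ω) {φ : E n → ℝ}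
    (h : tsupport φ ⊆ Ω) : eLpNorm φ 2 (volume.restrict Ω) = eLpNorm φ 2 volume := by
  rw [← eLpNorm_indicator_eq_eLpNorm_restrict hΩ, Set.indicator_eq_self.2]
  exact (subset_tsupport φ).trans h

theorem integrableOn_of_memLp_two (hΩ' : volume Ω ≠ ⊤) {f : E n → ℝ}
    (hf : MemLp f 2 (volume.restrict Ω)) : IntegrableOn f Ω := by
  have : IsFiniteMeasure (volume.restrict Ω) := ⟨by simpa using hΩ'.lt_top⟩
  exact hf.integrable (by norm_num)

theorem integrable_mul_fderiv {f φ : E n → ℝ} (hf : IntegrableOn f Ω) (hφ : ContDiff ℝ ∞ φ)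
    (hφc : HasCompactSupport φ) (m : E n) :
    Integrable (fun x => f x * fderiv ℝ φ x m) (volume.restrict Ω) := by
  have hc := (contDiff_fderiv_apply hφ m).continuous
  obtain ⟨B, hB⟩ := hc.bounded_above_of_compact_support (hφc.fderiv_apply (𝕜 := ℝ) m)
  exact Integrable.mul_bdd (c := B) hf hc.aestronglyMeasurable (.of_forall hB)

/-- A function in `L²(Ω)` whose distributional derivative is bounded in the `L²` norm has a weak
derivative in `L²(Ω)`. -/
theorem exists_hasWeakPartial (hΩ : IsOpen Ω) (hΩ' : volume Ω ≠ ⊤) {f : E n → ℝ}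
    (hf : MemLp f 2 (volume.restrict Ω)) (j : Fin n) {M : ℝ} (hM : 0 ≤ M)
    (h : ∀ φ : E n → ℝ, ContDiff ℝ ∞ φ → HasCompactSupport φ → tsupport φ ⊆ Ω →
      ‖∫ x in Ω, f x * fderiv ℝ φ x (e j)‖ₑ ≤ ENNReal.ofReal M * eLpNorm φ 2 volume) :
    ∃ g : E n → ℝ, HasWeakPartial Ω j f g ∧ MemLp g 2 (volume.restrict Ω) ∧
      ∫ x in Ω, g x ^ 2 ≤ M ^ 2 := by
  have hfi := integrableOn_of_memLp_two hΩ' hf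
  have hmem : ∀ φ : testFunctions Ω, MemLp (φ : E n → ℝ) 2 (volume.restrict Ω) := fun φ =>
    (φ.2.1.continuous.memLp_of_hasCompactSupport φ.2.2.1).restrict Ω
  let ι : testFunctions Ω →ₗ[ℝ] Lp ℝ 2 (volume.restrict Ω) :=
    { toFun := fun φ => (hmem φ).toLp φ
      map_add' := fun φ ψ => MemLp.toLp_add (hmem φ) (hmem ψ)
      map_smul' := fun a φ => MemLp.toLp_const_smul a (hmem φ) }
  let L : testFunctions Ω →ₗ[ℝ] ℝ :=
    { toFun := fun φ => -∫ x in Ω, f x * fderiv ℝ (φ : E n → ℝ) x (e j)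
      map_add' := fun φ ψ => by
        rw [← neg_add, ← integral_add (integrable_mul_fderiv hfi φ.2.1 φ.2.2.1 _)
          (integrable_mul_fderiv hfi ψ.2.1 ψ.2.2.1 _)]
        congr 1
        refine integral_congr_ae (.of_forall fun x => ?_)
        simp only [Submodule.coe_add]
        rw [fderiv_add (φ.2.1.differentiable (by simp) x) (ψ.2.1.differentiable (by simp) x),
          add_apply, mul_add]
      map_smul' := fun a φ => by
        simp only [RingHom.id_apply, smul_eq_mul]
        rw [mul_neg, ← integral_const_mul]
        congr 1
        refine integral_congr_ae (.of_forall fun x => ?_)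
        simp only [Submodule.coe_smul]
        rw [fderiv_const_smul (φ.2.1.differentiable (by simp) x), smul_apply, smul_eq_mul]
        ring }
  have hbound : ∀ φ, ‖L φ‖ ≤ M * ‖ι φ‖ := by
    intro φ
    have h1 := h φ φ.2.1 φ.2.2.1 φ.2.2.2
    rw [← eLpNorm_restrict_of_tsupport_subset hΩ.measurableSet φ.2.2.2] at h1
    have h2 : ‖ι φ‖ = (eLpNorm (φ : E n → ℝ) 2 (volume.restrict Ω)).toReal :=
      Lp.norm_toLp _ (hmem φ)
    have h3 := ENNReal.toReal_mono (ENNReal.mul_ne_top ENNReal.ofReal_ne_top (hmem φ).2.ne) h1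
    rw [ENNReal.toReal_mul, ENNReal.toReal_ofReal hM, toReal_enorm] at h3
    rw [h2]
    simpa [L] using h3
  obtain ⟨g, hg, hgL⟩ := exists_inner_eq_of_bound L ι hM hbound
  have hg2 : MemLp g 2 (volume.restrict Ω) := Lp.memLp g
  refine ⟨g, ⟨hfi.locallyIntegrableOn, (integrableOn_of_memLp_two hΩ' hg2).locallyIntegrableOn,
    fun φ h1 h2 h3 => ?_⟩, hg2, ?_⟩
  · have h4 := hgL ⟨φ, h1, h2, h3⟩
    rw [L2.inner_def] at h4
    have h5 : ∫ x in Ω, g x * φ x = L ⟨φ, h1, h2, h3⟩ := by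
      rw [← h4]
      refine integral_congr_ae ?_
      filter_upwards [(hmem ⟨φ, h1, h2, h3⟩).coeFn_toLp] with x hx
      rw [show (ι ⟨φ, h1, h2, h3⟩ : E n → ℝ) x = φ x from hx]
      simp [mul_comm]
    rw [h5]
    simp [L]
  · have h6 : ∫ x in Ω, g x ^ 2 = ‖g‖ ^ 2 := by
      rw [← real_inner_self_eq_norm_sq, L2.inner_def]
      refine integral_congr_ae (.of_forall fun x => ?_)
      simp [sq]
    rw [h6]
    exact pow_le_pow_left₀ (norm_nonneg _) hg 2

/-- The fundamental lemma of the calculus of variations; it makes the choice in `weakPartial`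
immaterial for L² norms. -/
theorem HasWeakPartial.ae_eq (hΩ : IsOpen Ω) {j : Fin n} {f g g' : E n → ℝ}
    (h : HasWeakPartial Ω j f g) (h' : HasWeakPartial Ω j f g') :
    g =ᵐ[volume.restrict Ω] g' := by
  have key := hΩ.ae_eq_zero_of_integral_contDiff_smul_eq_zero (μ := volume)
    (h.2.1.sub h'.2.1) fun φ h1 h2 h3 => by
      have hi : ∀ {g : E n → ℝ}, LocallyIntegrableOn g Ω →
          Integrable (fun x => g x * φ x) := by
        intro g hg
        have := (hg.integrableOn_compact_subset h3 h2)
        obtain ⟨B, hB⟩ := h1.continuous.bounded_above_of_compact_support h2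
        have h5 : IntegrableOn (fun x => g x * φ x) (tsupport φ) :=
          Integrable.mul_bdd (c := B) this h1.continuous.aestronglyMeasurable (.of_forall hB)
        refine (integrableOn_iff_integrable_of_support_subset ?_).1 h5
        exact (Function.support_mul_subset_right _ _).trans (subset_tsupport φ)
      have hset : ∀ g : E n → ℝ, ∫ x in Ω, g x * φ x = ∫ x, g x * φ x := fun g =>
        setIntegral_eq_integral_of_forall_compl_eq_zero fun x hx => by
          rw [image_eq_zero_of_notMem_tsupport fun hx' => hx (h3 hx'), mul_zero]
      have e1 := h.2.2 φ h1 h2 h3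
      rw [h'.2.2 φ h1 h2 h3, neg_inj, hset, hset] at e1
      calc ∫ x, φ x • (g - g') x = ∫ x, (g x * φ x - g' x * φ x) := by
            refine integral_congr_ae (.of_forall fun x => ?_)
            simp only [Pi.sub_apply, smul_eq_mul]
            ring
        _ = 0 := by
            rw [integral_sub (hi h.2.1) (hi h'.2.1), e1, sub_self]
  rw [Filter.EventuallyEq, ae_restrict_iff' hΩ.measurableSet]
  filter_upwards [key] with x hx hxΩ
  exact sub_eq_zero.1 (hx hxΩ)

theorem setIntegral_weakPartial_sq (hΩ : IsOpen Ω) {j : Fin n} {f g : E n → ℝ}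
    (h : HasWeakPartial Ω j f g) :
    ∫ x in Ω, weakPartial Ω j f x ^ 2 = ∫ x in Ω, g x ^ 2 := by
  have hex : ∃ g, HasWeakPartial Ω j f g := ⟨g, h⟩
  refine integral_congr_ae ?_
  rw [weakPartial, dif_pos hex]
  filter_upwards [hex.choose_spec.ae_eq hΩ h] with x hx
  rw [hx]

end PoincareEstimate

/-! ### Forms and their coefficients -/

namespace PoincareEstimate

open MeasureTheory
open scoped ContDiff ENNReal

section Forms

variable {n ℓ : ℕ}

/-- A component of a form on basis vectors vanishes, or is a coefficient up to sign. -/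
theorem component_eq_coeff (m : Fin ℓ → Fin n) :
    (∀ η : Form n ℓ, η (fun l => e (m l)) = 0) ∨
      ∃ (I : Fin ℓ ↪o Fin n) (s : ℝ), |s| = 1 ∧
        ∀ η : Form n ℓ, η (fun l => e (m l)) = s * coeff I η := by
  by_cases hm : Function.Injective m
  · right
    -- Sorting the distinct indices yields the increasing multi-index; the sign of the sorting
    -- permutation is s.
    set σ := Tuple.sort m
    have hmono : StrictMono (m ∘ σ) :=
      (Tuple.monotone_sort m).strictMono_of_injective (hm.comp σ.injective)
    refine ⟨OrderEmbedding.ofStrictMono _ hmono, ((Equiv.Perm.sign σ : ℤ) : ℝ), ?_, fun η => ?_⟩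
    · rcases Int.units_eq_one_or (Equiv.Perm.sign σ) with h | h <;> simp [h]
    · have h := η.toAlternatingMap.map_perm (fun l => e (m l)) σ
      have h' : coeff (OrderEmbedding.ofStrictMono _ hmono) η =
          Equiv.Perm.sign σ • η (fun l => e (m l)) := h
      rw [h']
      rcases Int.units_eq_one_or (Equiv.Perm.sign σ) with h | h <;> simp [h]
  · left
    intro η
    refine η.map_eq_zero_of_not_injective _ fun h => hm fun a b hab => h ?_
    simp only [hab]

/-- The coefficients determine a form, so a linear left inverse exists, continuous by finite
dimension. It transfers integrability from the coefficients to the form-valued function. -/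
theorem exists_coordinates_leftInverse (n ℓ : ℕ) :
    ∃ Ψ : ((Fin ℓ ↪o Fin n) → ℝ) →L[ℝ] Form n ℓ,
      ∀ η : Form n ℓ, Ψ (fun I => coeff I η) = η := by
  let Φ : Form n ℓ →ₗ[ℝ] ((Fin ℓ ↪o Fin n) → ℝ) :=
    { toFun := fun η I => coeff I η
      map_add' := fun η ξ => by ext I; simp [coeff]
      map_smul' := fun a η => by ext I; simp [coeff] }
  have hΦ : LinearMap.ker Φ = ⊥ := by
    refine LinearMap.ker_eq_bot'.2 fun η hη => ?_
    refine ContinuousAlternatingMap.toAlternatingMap_injective ?_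
    refine Module.Basis.ext_alternating (EuclideanSpace.basisFun (Fin n) ℝ).toBasis fun m _ => ?_
    have hb : ∀ i, (EuclideanSpace.basisFun (Fin n) ℝ).toBasis i = e i := fun i => by
      simp [e]
    simp only [hb]
    change η (fun l => e (m l)) = 0
    rcases component_eq_coeff (n := n) m with h | ⟨I, s, -, h⟩
    · exact h η
    · rw [h, show coeff I η = 0 from congrFun hη I, mul_zero]
  obtain ⟨Ψ, hΨ⟩ := LinearMap.exists_leftInverse_of_injective Φ hΦ
  exact ⟨LinearMap.toContinuousLinearMap Ψ, fun η => LinearMap.congr_fun hΨ η⟩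

theorem integrable_form_of_coeff {μ : Measure (E n)} {w : E n → Form n ℓ}
    (h : ∀ I, Integrable (fun y => coeff I (w y)) μ) : Integrable w μ := by
  obtain ⟨Ψ, hΨ⟩ := exists_coordinates_leftInverse n ℓ
  have h1 : Integrable (fun y I => coeff I (w y)) μ := Integrable.of_eval h
  exact (Ψ.integrable_comp h1).congr (.of_forall fun y => hΨ (w y))

theorem coeff_integral {μ : Measure (E n)} {w : E n → Form n ℓ} (hw : Integrable w μ)
    (I : Fin ℓ ↪o Fin n) : coeff I (∫ y, w y ∂μ) = ∫ y, coeff I (w y) ∂μ :=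
  ((ContinuousAlternatingMap.apply ℝ (E n) ℝ (fun l => e (I l))).integral_comp_comm hw).symm

/-- The coefficients of an interior product. -/
theorem coeff_contract {k : ℕ} (J : Fin k ↪o Fin n) (z : E n) (η : Form n (k + 1)) :
    coeff J (contract z η) = ∑ i, z i * η (fun l => e ((Fin.cons i J : Fin (k + 1) → Fin n) l)) := by
  have hz : z = ∑ i, z i • (e i : E n) := by
    conv_lhs => rw [← (EuclideanSpace.basisFun (Fin n) ℝ).sum_repr z]
    simp [e]
  have hcons : ∀ i, (fun l => e ((Fin.cons i J : Fin (k + 1) → Fin n) l)) =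
      (Matrix.vecCons (e i) (fun l => e (J l)) : Fin (k + 1) → E n) := by
    intro i
    funext l
    refine Fin.cases ?_ (fun l => ?_) l <;> simp
  let A : E n →ₗ[ℝ] ℝ :=
    { toFun := fun z => coeff J (contract z η)
      map_add' := fun a b => by simp [coeff, contract]
      map_smul' := fun a b => by simp [coeff, contract] }
  have hA : ∀ z, A z = coeff J (contract z η) := fun _ => rfl
  rw [← hA]
  conv_lhs => rw [hz]
  rw [map_sum]
  refine Finset.sum_congr rfl fun i _ => ?_
  rw [map_smul, smul_eq_mul, hcons, hA]
  rfl

theorem l2NormForm_nonneg (Ω : Set (E n)) (u : E n → Form n ℓ) : 0 ≤ l2NormForm Ω u :=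
  Real.sqrt_nonneg _

theorem eLpNorm_coeff_le {Ω : Set (E n)} {u : E n → Form n ℓ} (hu : MemL2Form Ω u)
    (I : Fin ℓ ↪o Fin n) :
    eLpNorm (fun x => coeff I (u x)) 2 (volume.restrict Ω) ≤ ENNReal.ofReal (l2NormForm Ω u) := by
  have h1 : eLpNorm (fun x => coeff I (u x)) 2 (volume.restrict Ω) =
      ENNReal.ofReal √(∫ x in Ω, coeff I (u x) ^ 2) := by
    rw [eLpNorm_two_eq_lintegral, ← ofReal_rpow_half (integral_nonneg fun x => sq_nonneg _),
      ofReal_integral_eq_lintegral_ofReal (hu I).integrable_sq (.of_forall fun x => sq_nonneg _)]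
    congr 1
    refine lintegral_congr fun x => ?_
    rw [← ofReal_norm, ← ENNReal.ofReal_pow (norm_nonneg _), Real.norm_eq_abs, sq_abs]
  rw [h1]
  refine ENNReal.ofReal_le_ofReal (Real.sqrt_le_sqrt ?_)
  exact Finset.single_le_sum (f := fun I => ∫ x in Ω, coeff I (u x) ^ 2)
    (fun I _ => integral_nonneg fun x => sq_nonneg _) (Finset.mem_univ I)

/-- Measurable representatives, supported in `Ω`, of the components of a square integrable form. -/
theorem exists_component_representative {Ω : Set (E n)} (hΩ : MeasurableSet Ω)
    (hΩ' : volume Ω ≠ ⊤) {u : E n → Form n ℓ} (hu : MemL2Form Ω u) (m : Fin ℓ → Fin n) :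
    ∃ v : E n → ℝ, Measurable v ∧ Integrable v ∧ MemLp v 2 ∧ (∀ x ∉ Ω, v x = 0) ∧
      (fun y => u y (fun l => e (m l))) =ᵐ[volume.restrict Ω] v ∧
      eLpNorm v 2 volume ≤ ENNReal.ofReal (l2NormForm Ω u) := by
  have hmem : MemLp (fun y => u y (fun l => e (m l))) 2 (volume.restrict Ω) ∧
      eLpNorm (fun y => u y (fun l => e (m l))) 2 (volume.restrict Ω) ≤
        ENNReal.ofReal (l2NormForm Ω u) := by
    rcases component_eq_coeff (n := n) m with h | ⟨I, s, hs, h⟩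
    · simp [h]
    · simp only [h]
      refine ⟨(hu I).const_mul s, ?_⟩
      refine le_trans (le_of_eq ?_) (eLpNorm_coeff_le hu I)
      refine eLpNorm_congr_norm_ae (.of_forall fun x => ?_)
      rw [norm_mul, Real.norm_eq_abs s, hs, one_mul]
  obtain ⟨h1, h2⟩ := hmem
  set w := h1.1.mk _
  have hw : StronglyMeasurable w := h1.1.stronglyMeasurable_mk
  have hwe : (fun y => u y (fun l => e (m l))) =ᵐ[volume.restrict Ω] w := h1.1.ae_eq_mk
  have hw2 : MemLp w 2 (volume.restrict Ω) := h1.ae_eq hwe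
  refine ⟨Ω.indicator w, hw.measurable.indicator hΩ, ?_, ?_,
    fun x hx => Set.indicator_of_notMem hx _, ?_, ?_⟩
  · exact (integrable_indicator_iff hΩ).2 (integrableOn_of_memLp_two hΩ' hw2)
  · exact (memLp_indicator_iff_restrict hΩ).2 hw2
  · exact hwe.trans (indicator_ae_eq_restrict hΩ).symm
  · rw [eLpNorm_indicator_eq_eLpNorm_restrict hΩ, ← eLpNorm_congr_ae hwe]
    exact h2

end Forms

end PoincareEstimate

/-! ### From the scalar operators to forms -/

namespace PoincareEstimate

open MeasureTheory
open scoped ContDiff ENNReal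

/-- The coefficients of `poincareIntegrand` in terms of the components of the form. -/
theorem coeff_poincareIntegrand {n k : ℕ} (hk : k + 1 ≤ n) (θ : E n → ℝ)
    (u : E n → Form n (k + 1)) (J : Fin k ↪o Fin n) (x y : E n) :
    coeff J (poincareIntegrand θ u x y) = ∑ i, scaleKernel k θ x y * (x - y) i *
      u y (fun l => e ((Fin.cons i J : Fin (k + 1) → Fin n) l)) := by
  have h1 : coeff J (poincareIntegrand θ u x y) =
      G θ ((n : ℤ) - ((k + 1 : ℕ) : ℤ) + 1) y x * coeff J (contract (x - y) (u y)) := rfl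
  rw [h1, G_eq_integral_sliceKernel hk, coeff_contract, Finset.mul_sum]
  refine Finset.sum_congr rfl fun i _ => ?_
  rw [← mul_assoc]
  rfl

end PoincareEstimate

open MeasureTheory PoincareEstimate in
/-- The degree of the forms is `ℓ = k + 1`, with `1 ≤ ℓ ≤ n`; the constant `C` depends only on
`n`, `ℓ` and the constants `K` in the bounds on the derivatives of `θ`. -/
theorem mainTheorem1 (n k : ℕ) (hk : k + 1 ≤ n) (K : ℕ → ℝ) :
    ∃ C : ℝ, ∀ (Ω : Set (E n)) (c : E n) (r : ℝ) (θ : E n → ℝ),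
      IsOpen Ω → Bornology.IsBounded Ω → 0 < r → StarShapedWrt Ω (Metric.ball c r) →
      IsRegularizer K c r θ →
      ∀ u : E n → Form n (k + 1), MemL2Form Ω u →
        (∀ᵐ x ∂(volume.restrict Ω), IntegrableOn (poincareIntegrand θ u x) Ω) ∧
        MemH1Form Ω (poincareOp Ω θ u) ∧
        h1SeminormForm Ω (poincareOp Ω θ u) ≤
          C * (Metric.diam Ω / Metric.diam (Metric.ball c r)) *
            kappa n (k + 1) (volume.real Ω / volume.real (Metric.ball c r)) *
            l2NormForm Ω u := by
  obtain ⟨C, hC, hpair⟩ := exists_pairing_bound n k hk K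
  -- The inner n counts the scalar operators in one coefficient; the square root counts the pairs
  -- (J, j) in the seminorm.
  refine ⟨√(Fintype.card (Fin k ↪o Fin n) * n) * (n * C), ?_⟩
  intro Ω c r θ hΩ hΩb hr hstar hreg u hu
  have hΩm := hΩ.measurableSet
  have hΩ' : volume Ω ≠ ⊤ := hΩb.measure_lt_top.ne
  have hc : c ∈ Ω := hstar.1 (Metric.mem_ball_self hr)
  have hΩR : ∀ x ∈ Ω, ‖x - c‖ ≤ Metric.diam Ω := fun x hx => norm_sub_le_diam hΩb hx hc
  have hθ := hreg.contDiff.continuous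
  have hθi : Integrable θ := hθ.integrable_of_hasCompactSupport hreg.hasCompactSupport
  have hθs : ∀ a, θ a ≠ 0 → ‖a - c‖ ≤ r := fun a ha =>
    hreg.norm_sub_le_of_mem_tsupport (subset_tsupport _ ha)
  -- v J i represents the component of u on (e_i, e_J), extended by zero; the index tuple i, J need
  -- not be increasing or even injective.
  choose v hvm hvi hv2 hv0 hve hvn using fun (J : Fin k ↪o Fin n) (i : Fin n) =>
    exists_component_representative hΩm hΩ' hu (Fin.cons i J : Fin (k + 1) → Fin n)
  have hq1 : 1 ≤ volume.real Ω / volume.real (Metric.ball c r) := by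
    have hBpos : 0 < volume.real (Metric.ball c r) :=
      ENNReal.toReal_pos (Metric.measure_ball_pos _ _ hr).ne' measure_ball_lt_top.ne
    rw [one_le_div hBpos]
    exact measureReal_mono hstar.1 hΩ'
  have hκ := one_le_kappa n (k + 1) hq1
  have hU := l2NormForm_nonneg Ω u
  set κ := kappa n (k + 1) (volume.real Ω / volume.real (Metric.ball c r))
  set D := Metric.diam Ω / Metric.diam (Metric.ball c r) with hD
  have hD0 : 0 ≤ D := div_nonneg Metric.diam_nonneg Metric.diam_nonneg
  have hcoeff : ∀ (J : Fin k ↪o Fin n) (x : E n),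
      (fun y => coeff J (poincareIntegrand θ u x y)) =ᵐ[volume.restrict Ω]
        fun y => ∑ i, scaleKernel k θ x y * (x - y) i * v J i y := by
    intro J x
    filter_upwards [ae_all_iff.2 (hve J)] with y hy
    rw [coeff_poincareIntegrand hk]
    exact Finset.sum_congr rfl fun i _ => by rw [← hy i]
  have hint : ∀ᵐ x ∂(volume.restrict Ω), ∀ J i,
      Integrable fun y => scaleKernel k θ x y * (x - y) i * v J i y :=
    ae_all_iff.2 fun J => ae_all_iff.2 fun i =>
      ae_integrable_scalarOp hk hθ hθi hθs hreg.abs_le hΩm hΩR hΩ' i (hvm J i) (hvi J i)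
  have hA : ∀ᵐ x ∂(volume.restrict Ω), IntegrableOn (poincareIntegrand θ u x) Ω := by
    filter_upwards [hint] with x hx
    refine integrable_form_of_coeff fun J => ?_
    exact (integrable_finsetSum _ fun i _ => (hx J i).restrict).congr (hcoeff J x).symm
  have hop : ∀ J, (fun x => coeff J (poincareOp Ω θ u x)) =ᵐ[volume.restrict Ω]
      fun x => ∑ i, scalarOp k θ i (v J i) x := by
    intro J
    filter_upwards [hint, hA] with x hx hxA
    rw [poincareOp, coeff_integral hxA, integral_congr_ae (hcoeff J x),
      integral_finsetSum _ fun i _ => (hx J i).restrict]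
    refine Finset.sum_congr rfl fun i _ => ?_
    refine setIntegral_eq_integral_of_forall_compl_eq_zero fun y hy => ?_
    rw [hv0 J i y hy, mul_zero]
  have hscal : ∀ J i, MemLp (scalarOp k θ i (v J i)) 2 (volume.restrict Ω) := fun J i =>
    memLp_scalarOp hk hθ hθi hθs hreg.abs_le hΩm hΩR hΩ' i (hvm J i) (hv2 J i)
  have hmem : ∀ J, MemLp (fun x => coeff J (poincareOp Ω θ u x)) 2 (volume.restrict Ω) :=
    fun J => (memLp_finsetSum _ fun i _ => hscal J i).ae_eq (hop J).symm
  set M := n * (C * D * κ * l2NormForm Ω u) with hM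
  have hM0 : 0 ≤ M := by positivity
  have hweak : ∀ J j, ∃ g : E n → ℝ,
      HasWeakPartial Ω j (fun x => coeff J (poincareOp Ω θ u x)) g ∧
        MemLp g 2 (volume.restrict Ω) ∧ ∫ x in Ω, g x ^ 2 ≤ M ^ 2 := by
    intro J j
    refine exists_hasWeakPartial hΩ hΩ' (hmem J) j hM0 fun φ hφ hφc hφΩ => ?_
    have e1 : ∫ x in Ω, coeff J (poincareOp Ω θ u x) * fderiv ℝ φ x (e j) =
        ∑ i, ∫ x in Ω, scalarOp k θ i (v J i) x * fderiv ℝ φ x (e j) := by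
      rw [← integral_finsetSum _ fun i _ =>
        integrable_mul_fderiv (integrableOn_of_memLp_two hΩ' (hscal J i)) hφ hφc _]
      refine integral_congr_ae ?_
      filter_upwards [hop J] with x hx
      rw [hx, Finset.sum_mul]
    rw [e1]
    calc _ ≤ ∑ i, ‖∫ x in Ω, scalarOp k θ i (v J i) x * fderiv ℝ φ x (e j)‖ₑ :=
          enorm_sum_le _ _
      _ ≤ ∑ _i : Fin n, ENNReal.ofReal (C * D * κ) *
          (eLpNorm φ 2 volume * ENNReal.ofReal (l2NormForm Ω u)) := by
          refine Finset.sum_le_sum fun i _ => ?_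
          refine (hpair Ω c r θ hΩ hΩb hr hstar hreg i j (v J i) φ (hvm J i) (hvi J i) (hv2 J i)
            hφ hφc hφΩ).trans ?_
          gcongr
          exact hvn J i
      _ = _ := by
          rw [Finset.sum_const, Finset.card_univ, Fintype.card_fin, nsmul_eq_mul, hM,
            ENNReal.ofReal_mul (p := (n : ℝ)) (by positivity),
            ENNReal.ofReal_mul (p := C * D * κ) (by positivity), ENNReal.ofReal_natCast]
          ring
  refine ⟨hA, fun J => ⟨hmem J, fun j => ?_⟩, ?_⟩
  · obtain ⟨g, h1, h2, -⟩ := hweak J j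
    exact ⟨g, h1, h2⟩
  · have hsum : ∑ J : Fin k ↪o Fin n, ∑ j : Fin n,
        ∫ x in Ω, weakPartial Ω j (fun y => coeff J (poincareOp Ω θ u y)) x ^ 2 ≤
        (Fintype.card (Fin k ↪o Fin n) * n) * M ^ 2 := by
      calc _ ≤ ∑ _J : Fin k ↪o Fin n, ∑ _j : Fin n, M ^ 2 := by
            refine Finset.sum_le_sum fun J _ => Finset.sum_le_sum fun j _ => ?_
            obtain ⟨g, h1, -, h3⟩ := hweak J j
            rwa [setIntegral_weakPartial_sq hΩ h1]
        _ = _ := by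
            simp only [Finset.sum_const, Finset.card_univ, Fintype.card_fin, nsmul_eq_mul]
            ring
    calc h1SeminormForm Ω (poincareOp Ω θ u)
        ≤ √((Fintype.card (Fin k ↪o Fin n) * n) * M ^ 2) := Real.sqrt_le_sqrt hsum
      _ = √(Fintype.card (Fin k ↪o Fin n) * n) * M := by
          rw [Real.sqrt_mul (by positivity), Real.sqrt_sq hM0]
      _ = _ := by
          rw [hM]
          ring
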